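/- Let $\mu$ be a Borel probability measure with infinite support on the unit circle $\mathbb{T}=\{z\in\mathbb{C}:|z|=1\}$, and let $(x_n)_{n\ge 0}$ be a sequence of orthonormal Laurent polynomials for $\mu$ obtained by orthonormalizing $1,z^{-1},z,z^{-2},z^{2},\dots$ in $L^2(\mu)$. That is, $x_n$ lies in the span of the first $n+1$ of these powers for every $n$, and $\int_{\mathbb{T}} x_m\,\overline{x_n}\,d\mu=\delta_{mn}$ for all $m,n\ge 0$. By a linear differential operator of order $r$ on $\mathbb{C}[z,z^{-1}]$ we mean a linear map $D:\mathbb{C}[z,z^{-1}]\to\mathbb{C}[z,z^{-1}]$ of the form $D=\sum_{k=0}^{r}D_k(z)\frac{d^k}{dz^k}$, where the $D_k$ are functions on $\mathbb{C}\setminus\{0\}$ and $D_r$ is not identically zero. Then the following are equivalent: 1. There are an integer $r\ge 1$, a linear differential operator $D$ of order $r$ on $\mathbb{C}[z,z^{-1}]$ and an $n_0\in\mathbb{N}$ such that $$D x_n\in\operatorname{span}\{x_{n-1},x_n,x_{n+1}\}\qquad\text{for all } n\ge n_0,$$ where $x_{-1}:=0$. 2. The $x_n$ are orthonormal with respect to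 the normalized Lebesgue measure $\frac{d\theta}{2\pi}$ on $\mathbb{T}$. -/

import Mathlib

open MeasureTheory
open scoped LaurentPolynomial ComplexConjugate

noncomputable section

namespace CMVBispectral

/-- The value `f(z)` of a Laurent polynomial `f ∈ ℂ[z, z⁻¹]` at a point `z ∈ ℂ ∖ {0}`. -/
def ev (z : ℂˣ) : ℂ[T;T⁻¹] →+* ℂ :=
  LaurentPolynomial.eval₂ (RingHom.id ℂ) z

/-- The derivative `d/dz` on `ℂ[z, z⁻¹]`: `∑ₙ cₙ zⁿ ↦ ∑ₙ n cₙ zⁿ⁻¹`. -/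
def ddz (f : ℂ[T;T⁻¹]) : ℂ[T;T⁻¹] :=
  f.coeff.sum fun n c => LaurentPolynomial.C ((n : ℂ) * c) * LaurentPolynomial.T (n - 1)

/-- `D` is a linear differential operator on `ℂ[z, z⁻¹]` of order exactly `r`: it is given by
`D = ∑_{k=0}^r a_k(z) dᵏ/dzᵏ` with coefficient functions `a_k` on `ℂ ∖ {0}`, where `a_r` is not
identically zero. No regularity of the `a_k` is assumed; what is required is that `D` maps Laurent
polynomials to Laurent polynomials. -/
def IsDiffOp (r : ℕ) (D : ℂ[T;T⁻¹] →ₗ[ℂ] ℂ[T;T⁻¹]) : Prop :=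
  ∃ a : ℕ → ℂˣ → ℂ, a r ≠ 0 ∧
    ∀ (f : ℂ[T;T⁻¹]) (z : ℂˣ),
      ev z (D f) = ∑ k ∈ Finset.range (r + 1), a k z * ev z (ddz^[k] f)

/-- The exponents of the sequence `1, z⁻¹, z, z⁻², z², …`: `0, -1, 1, -2, 2, …`. -/
def cmvExp (n : ℕ) : ℤ :=
  if Even n then (n : ℤ) / 2 else -(((n : ℤ) + 1) / 2)

/-- The Borel σ-algebra on the unit circle. -/
instance circleMeasurableSpace : MeasurableSpace Circle := borel Circle

instance circleBorelSpace : BorelSpace Circle := ⟨rfl⟩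

/-- `x` is a sequence of orthonormal Laurent polynomials obtained by orthonormalization of
`1, z⁻¹, z, z⁻², z², …` in `L²(μ)`: it is orthonormal, and `x n` lies in the span of the first
`n + 1` of these powers. (This determines each `x n` up to a factor of modulus one.) -/
structure IsOLP (μ : Measure Circle) (x : ℕ → ℂ[T;T⁻¹]) : Prop where
  mem_span : ∀ n, x n ∈ Submodule.span ℂ
    ((fun k => (LaurentPolynomial.T (cmvExp k) : ℂ[T;T⁻¹])) '' Set.Iic n)
  orthonormal : ∀ m n, ∫ z : Circle, ev z.toUnits (x m) * conj (ev z.toUnits (x n)) ∂μ =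
    if m = n then 1 else 0

/-- The normalized Lebesgue measure `dθ / 2π` on the unit circle. -/
def lebesgueCircle : Measure Circle :=
  Measure.map Circle.exp
    (ENNReal.ofReal (2 * Real.pi)⁻¹ • (volume : Measure ℝ).restrict (Set.Ioc 0 (2 * Real.pi)))

end CMVBispectral

end

/-!
Reversing and conjugating the coefficients turns `xₙ` into a Szegő polynomial `Φₙ`, which is
monic of degree `n` and satisfies `Φₙ₊₁ = z Φₙ + γₙ₊₁ Φₙ*` with `|γₙ₊₁| < 1`. An operator `D` as in
the theorem is a polynomial in `z d/dz`: a term of `D` that shifts powers of `z` would move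
infinitely many of them by more than one step in the order `1, z⁻¹, z, z⁻², z², …`. So `D` is
diagonal in the powers of `z`, and comparing extreme coefficients reduces its three-term relation
to `(D - λ) Φₙ₊₁ = κ Φₙ*`.

The coefficients of `z` and `zⁿ` in this relation and in Szegő's recurrence express `|γₙ₊₁|²`
through eigenvalues of `D` whenever the subdiagonal coefficient of `Φₙ` is nonzero. For a symbol of
even degree this contradicts `|γₙ₊₁| < 1` for all large `n` of one parity, and so it does in degree
one; in odd degree at least three it makes the subdiagonal coefficients grow faster than linearly,
whereas Szegő's recurrence bounds them by `n`. Hence the subdiagonal vanishes along a parity class,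
which forces `γₙ = 0` for all large `n` and then `Φₙ = zⁿ`, first for large `n` and by downward
recursion for all `n`. The `xₙ` are thus unimodular multiples of powers of `z`, as they are exactly
for Lebesgue measure.
-/

noncomputable section

namespace CMVBispectral

open Filter Topology Polynomial Bornology

section PolynomialsAtInfinity

variable {𝕜 : Type*} [NormedField 𝕜]

lemma eventually_eval_ne_zero {q : 𝕜[X]} (hq : q ≠ 0) : ∀ᶠ t in cobounded 𝕜, q.eval t ≠ 0 := by
  classical
  have hbounded : IsBounded (q.roots.toFinset : Set 𝕜) := q.roots.toFinset.finite_toSet.isBounded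
  filter_upwards [isBounded_def.mp hbounded] with t ht hroot
  exact ht (by simpa [hq] using hroot)

lemma eventually_eval_ne {q r : 𝕜[X]} (h : q ≠ r) : ∀ᶠ t in cobounded 𝕜, q.eval t ≠ r.eval t := by
  filter_upwards [eventually_eval_ne_zero (sub_ne_zero.mpr h)] with t ht
  rwa [eval_sub, sub_ne_zero] at ht

lemma tendsto_eval_div_pow {q : 𝕜[X]} {m : ℕ} (hq : q.natDegree ≤ m) :
    Tendsto (fun t => q.eval t / t ^ m) (cobounded 𝕜) (𝓝 (q.coeff m)) := by
  have hlim : Tendsto (fun t : 𝕜 => (q.reflect m).eval t⁻¹) (cobounded 𝕜) (𝓝 (q.coeff m)) := by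
    have h := ((q.reflect m).continuous.tendsto 0).comp tendsto_inv₀_cobounded
    rwa [← coeff_zero_eq_eval_zero, coeff_reflect, revAt_zero] at h
  refine hlim.congr' ?_
  filter_upwards [eventually_ne_cobounded 0] with t ht
  let := invertibleOfNonzero ht
  rw [eq_div_iff (pow_ne_zero m ht), ← invOf_eq_inv]
  exact eval₂_reflect_mul_pow (RingHom.id 𝕜) t m q hq

lemma coeff_taylor_of_natDegree_le {R : Type*} [CommRing R] {q : R[X]} {m : ℕ}
    (hq : q.natDegree ≤ m + 1) (c : R) :
    (taylor c q).coeff m = q.coeff m + (m + 1) * c * q.coeff (m + 1) := by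
  have hderiv : (hasseDeriv m q).natDegree ≤ 1 := by
    have := natDegree_hasseDeriv_le q m
    omega
  rw [taylor_coeff, eval_eq_sum_range' (Nat.lt_succ_of_le hderiv)]
  simp only [hasseDeriv_coeff, Finset.sum_range_succ, Finset.range_one, Finset.sum_singleton,
    zero_add, Nat.choose_self, Nat.cast_one, one_mul, pow_zero, mul_one, add_comm 1 m,
    Nat.choose_succ_self_right, Nat.cast_add, pow_one]
  ring

lemma tendsto_eval_add_sub_div {q : 𝕜[X]} {m : ℕ} (hq : q.natDegree ≤ m + 1) (c : 𝕜) :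
    Tendsto (fun t => (q.eval (t + c) - q.coeff (m + 1) * t ^ (m + 1)) / t ^ m) (cobounded 𝕜)
      (𝓝 (q.coeff m + (m + 1) * c * q.coeff (m + 1))) := by
  have htop : (taylor c q).coeff (m + 1) = q.coeff (m + 1) := by
    rw [coeff_taylor_of_natDegree_le (hq.trans (Nat.le_succ _)),
      coeff_eq_zero_of_natDegree_lt (Nat.lt_succ_of_le hq), mul_zero, add_zero]
  set r := taylor c q - C (q.coeff (m + 1)) * X ^ (m + 1) with hr
  have hdeg : r.natDegree ≤ m := by
    refine natDegree_le_iff_coeff_eq_zero.mpr fun k hk => ?_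
    rcases (Nat.succ_le_of_lt hk).eq_or_lt with rfl | hlt
    · simp [hr, htop]
    · have hzero : (taylor c q).coeff k = 0 :=
        coeff_eq_zero_of_natDegree_lt (by rw [natDegree_taylor]; omega)
      have hne : k ≠ m + 1 := by omega
      simp [hr, hzero, coeff_X_pow, hne]
  have hcoeff : r.coeff m = q.coeff m + (m + 1) * c * q.coeff (m + 1) := by
    simp [hr, coeff_taylor_of_natDegree_le hq, coeff_X_pow]
  have h := tendsto_eval_div_pow hdeg
  rw [hcoeff] at h
  simpa [hr, taylor_eval] using h

lemma tendsto_eval_sub_sub_div {q : 𝕜[X]} {m : ℕ} (hq : q.natDegree ≤ m + 1) (hm : Odd m)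
    (c : 𝕜) :
    Tendsto (fun t => (q.eval (c - t) - q.coeff (m + 1) * t ^ (m + 1)) / t ^ m) (cobounded 𝕜)
      (𝓝 (-(q.coeff m + (m + 1) * c * q.coeff (m + 1)))) := by
  refine ((tendsto_eval_add_sub_div hq c).comp tendsto_neg_cobounded).neg.congr fun t => ?_
  simp only [Function.comp_apply, hm.neg_pow, (hm.add_odd odd_one).neg_pow, div_neg, neg_neg,
    neg_add_eq_sub]

end PolynomialsAtInfinity

section Symmetry

variable {𝕜 : Type*} [Field 𝕜]

/-- The reflection `t ↦ c - t` about `c / 2` preserves `q`. -/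
def IsReflectionInvariant (q : 𝕜[X]) (c : 𝕜) : Prop :=
  q.comp (C c - X) = q

variable [CharZero 𝕜]

lemma taylor_ne_self {q : 𝕜[X]} (hq : 0 < q.natDegree) {d : 𝕜} (hd : d ≠ 0) : taylor d q ≠ q := by
  obtain ⟨m, hm⟩ := Nat.exists_eq_add_one.mpr hq
  intro h
  have hcoeff := coeff_taylor_of_natDegree_le hm.le d
  have hlead : q.coeff (m + 1) ≠ 0 := by
    rw [← hm, coeff_natDegree, leadingCoeff_ne_zero]
    exact ne_zero_of_natDegree_gt hq
  rw [h, left_eq_add] at hcoeff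
  exact mul_ne_zero (mul_ne_zero (Nat.cast_add_one_ne_zero m) hd) hlead hcoeff

lemma IsReflectionInvariant.eq {q : 𝕜[X]} (hq : 0 < q.natDegree) {c d : 𝕜}
    (hc : IsReflectionInvariant q c) (hd : IsReflectionInvariant q d) : c = d := by
  by_contra hne
  refine taylor_ne_self hq (sub_ne_zero.mpr hne) ?_
  calc taylor (c - d) q = (q.comp (C c - X)).comp (C d - X) := by
        rw [taylor_apply, comp_assoc]
        congr 1
        simp only [sub_comp, C_comp, X_comp, C_sub]
        ring
    _ = q := by rw [hc, hd]

lemma IsReflectionInvariant.even_natDegree {q : 𝕜[X]} {c : 𝕜} (h : IsReflectionInvariant q c) :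
    Even q.natDegree := by
  rcases eq_or_ne q 0 with rfl | hq
  · simp
  have hneg : C c - X = -(X - C c) := (neg_sub X (C c)).symm
  have hlead := congrArg leadingCoeff h
  rw [leadingCoeff_comp (by rw [hneg, natDegree_neg, natDegree_X_sub_C]; exact one_ne_zero), hneg,
    leadingCoeff_neg, leadingCoeff_X_sub_C, mul_eq_left₀ (leadingCoeff_ne_zero.mpr hq)] at hlead
  exact (neg_one_pow_eq_one_iff_even (by norm_num)).mp hlead

end Symmetry

section

variable {𝕜 : Type*} [NormedField 𝕜]

lemma eventually_eval_add_ne [CharZero 𝕜] {q : 𝕜[X]} (hq : 0 < q.natDegree) {d : 𝕜} (hd : d ≠ 0) :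
    ∀ᶠ t in cobounded 𝕜, q.eval (t + d) ≠ q.eval t := by
  simpa only [taylor_eval] using eventually_eval_ne (taylor_ne_self hq hd)

lemma eventually_eval_sub_ne {q : 𝕜[X]} {c : 𝕜} (hc : ¬ IsReflectionInvariant q c) :
    ∀ᶠ t in cobounded 𝕜, q.eval (c - t) ≠ q.eval t := by
  simpa using eventually_eval_ne hc

end

lemma tendsto_natCast_div_two_cobounded :
    Tendsto (fun n : ℕ => (n : ℂ) / 2) atTop (cobounded ℂ) := by
  simp only [div_eq_inv_mul]
  exact (tendsto_mul_left_cobounded (by norm_num)).comp tendsto_natCast_atTop_cobounded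

/-- The polynomial `t ↦ conj (p (-1/2 - conj t))`. Reversing and conjugating the coefficients of a
Laurent polynomial turns eigenvalues given by `p` into eigenvalues given by `conjReflect p`, up to
the shift by `1/2` that makes the reversal centred at every degree. -/
def conjReflect (p : ℂ[X]) : ℂ[X] :=
  taylor (1 / 2) ((p.map (starRingEnd ℂ)).comp (-X))

section ConjReflect

variable {p : ℂ[X]}

lemma eval_conjReflect (p : ℂ[X]) (t : ℂ) :
    (conjReflect p).eval t = conj (p.eval (-(1 / 2) - conj t)) := by
  have harg : -(t + 1 / 2) = conj (-(1 / 2) - conj t) := by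
    simp only [map_sub, map_neg, map_div₀, map_one, map_ofNat, Complex.conj_conj]
    ring
  rw [conjReflect, taylor_eval, eval_comp, eval_neg, eval_X, harg, eval_map, eval₂_at_apply]

lemma conjReflect_involutive : Function.Involutive conjReflect := fun p =>
  Polynomial.funext fun t => by
    simp only [eval_conjReflect, map_sub, map_neg, map_div₀, map_one, map_ofNat,
      Complex.conj_conj, sub_sub_cancel]

lemma natDegree_conjReflect (p : ℂ[X]) : (conjReflect p).natDegree = p.natDegree := by
  simp [conjReflect, natDegree_comp]

lemma natDegree_iterate_conjReflect (p : ℂ[X]) (n : ℕ) :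
    (conjReflect^[n] p).natDegree = p.natDegree := by
  induction n with
  | zero => rfl
  | succ n ih => rw [Function.iterate_succ_apply', natDegree_conjReflect, ih]

lemma iterate_conjReflect_two_mul_add (p : ℂ[X]) (k ε : ℕ) :
    conjReflect^[2 * k + ε] p = conjReflect^[ε] p := by
  rw [add_comm, Function.iterate_add_apply, conjReflect_involutive.iterate_two_mul, id]

lemma IsReflectionInvariant.of_conjReflect {c : ℂ}
    (h : IsReflectionInvariant (conjReflect p) c) :
    IsReflectionInvariant p (-1 - conj c) := by
  refine Polynomial.funext fun t => ?_
  have ht := congrArg (fun q => conj (q.eval (-(1 / 2) - conj t))) h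
  simp only [eval_comp, eval_sub, eval_C, eval_X, eval_conjReflect, map_sub, map_neg, map_div₀,
    map_one, map_ofNat, Complex.conj_conj, sub_sub_cancel] at ht
  rw [← ht, eval_comp]
  congr 1
  simp only [eval_sub, eval_C, eval_X]
  ring

lemma re_conj_coeff_mul_coeff_conjReflect {m : ℕ} (hp : p.natDegree ≤ m + 1) (hm : Odd m) :
    (conj ((conjReflect p).coeff (m + 1)) * (conjReflect p).coeff m).re =
      (m + 1) / 2 * Complex.normSq (p.coeff (m + 1)) - (conj (p.coeff (m + 1)) * p.coeff m).re := by
  set r := (p.map (starRingEnd ℂ)).comp (-X) with hr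
  have hcoeff (i : ℕ) : r.coeff i = conj (p.coeff i) * (-1) ^ i := by
    rw [hr, neg_eq_neg_one_mul, ← C_1, ← C_neg, comp_C_mul_X_coeff, coeff_map]
  have hdeg : r.natDegree ≤ m + 1 := by simpa [hr, natDegree_comp] using hp
  have hlead : r.coeff (m + 1) = conj (p.coeff (m + 1)) := by
    rw [hcoeff, (hm.add_odd odd_one).neg_one_pow, mul_one]
  have hnext : r.coeff m = -conj (p.coeff m) := by
    rw [hcoeff, hm.neg_one_pow, mul_neg_one]
  rw [conjReflect, ← hr, coeff_taylor_of_natDegree_le (hdeg.trans (Nat.le_succ _)),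
    coeff_taylor_of_natDegree_le hdeg, hlead, hnext,
    coeff_eq_zero_of_natDegree_lt (Nat.lt_succ_of_le hdeg)]
  have hscalar : p.coeff (m + 1) *
      (-conj (p.coeff m) + (m + 1) * (1 / 2) * conj (p.coeff (m + 1))) =
        ((m + 1) / 2 * Complex.normSq (p.coeff (m + 1)) : ℝ) -
          conj (conj (p.coeff (m + 1)) * p.coeff m) := by
    push_cast
    rw [Complex.normSq_eq_conj_mul_self, map_mul, Complex.conj_conj]
    ring
  rw [mul_zero, add_zero, Complex.conj_conj, hscalar, Complex.sub_re, Complex.ofReal_re,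
    Complex.conj_re]

lemma exists_iterate_conjReflect_re_pos {m : ℕ} (hp : p.natDegree = m + 1) (hm : Odd m) :
    ∃ ε, 0 < (conj ((conjReflect^[ε + 1] p).coeff (m + 1)) *
      (conjReflect^[ε + 1] p).coeff m).re := by
  rcases lt_or_ge 0 (conj (p.coeff (m + 1)) * p.coeff m).re with hpos | hneg
  · exact ⟨1, by rwa [iterate_conjReflect_two_mul_add p 1 0, Function.iterate_zero, id]⟩
  · refine ⟨0, ?_⟩
    have hlead : p.coeff (m + 1) ≠ 0 := by
      rw [← hp, coeff_natDegree, leadingCoeff_ne_zero]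
      exact ne_zero_of_natDegree_gt (n := 0) (by omega)
    rw [zero_add, Function.iterate_one, re_conj_coeff_mul_coeff_conjReflect hp.le hm]
    have := Complex.normSq_pos.mpr hlead
    have : 0 < ((m : ℝ) + 1) / 2 * Complex.normSq (p.coeff (m + 1)) := by positivity
    linarith

lemma eventually_iterate_conjReflect {P : ℂ[X] → ℂ → Prop}
    (h : ∀ q : ℂ[X], q.natDegree = p.natDegree → ∀ᶠ t in cobounded ℂ, P q t) :
    ∀ᶠ n : ℕ in atTop, P (conjReflect^[n] p) (n / 2) := by
  filter_upwards [tendsto_natCast_div_two_cobounded.eventually (h p rfl),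
    tendsto_natCast_div_two_cobounded.eventually (h (conjReflect p) (natDegree_conjReflect p))]
    with n heven hodd
  rcases n.even_or_odd with hn | hn
  · rwa [conjReflect_involutive.iterate_even hn]
  · rwa [conjReflect_involutive.iterate_odd hn]

end ConjReflect

lemma tendsto_re_conj_sub_mul_sub {α : Type*} {l : Filter α} {u v w z f d : α → ℂ}
    {u₀ v₀ w₀ z₀ : ℂ} (hu : Tendsto (fun t => (u t - f t) / d t) l (𝓝 u₀))
    (hv : Tendsto (fun t => (v t - f t) / d t) l (𝓝 v₀))
    (hw : Tendsto (fun t => (w t - f t) / d t) l (𝓝 w₀))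
    (hz : Tendsto (fun t => (z t - f t) / d t) l (𝓝 z₀)) :
    Tendsto (fun t => (conj (u t - v t) * (w t - z t)).re / Complex.normSq (d t)) l
      (𝓝 (conj (u₀ - v₀) * (w₀ - z₀)).re) := by
  refine ((Complex.continuous_re.tendsto _).comp
    (((Complex.continuous_conj.tendsto _).comp (hu.sub hv)).mul (hw.sub hz))).congr fun t => ?_
  simp only [Function.comp_apply]
  rw [← sub_div, ← sub_div, sub_sub_sub_cancel_right, sub_sub_sub_cancel_right, map_div₀,
    div_mul_div_comm, ← Complex.normSq_eq_conj_mul_self, Complex.div_ofReal_re]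

lemma re_conj_mul_two_mul_add (s : ℝ) (a b : ℂ) :
    (conj (s * a) * (2 * b + s * a)).re =
      s ^ 2 * Complex.normSq a + 2 * s * (conj a * b).re := by
  have hexpand : conj (s * a) * (2 * b + s * a) =
      (s ^ 2 * Complex.normSq a : ℝ) + (2 * s : ℝ) * (conj a * b) := by
    push_cast
    rw [Complex.normSq_eq_conj_mul_self, map_mul, Complex.conj_ofReal]
    ring
  rw [hexpand, Complex.add_re, Complex.ofReal_re, Complex.re_ofReal_mul]

lemma eventually_mul_re_lt_re {q : ℂ[X]} {m : ℕ} (hq : q.natDegree ≤ m + 1) (hm : Odd m)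
    (hpos : 0 < (conj (q.coeff (m + 1)) * q.coeff m).re) :
    ∀ᶠ t in cobounded ℂ, ∀ g ∈ Set.Icc (0 : ℝ) 1,
      g * (conj (q.eval (-t) - q.eval (1 - t)) * (q.eval (-t) - q.eval (t - 1))).re <
        (conj (q.eval (1 - t) - q.eval t) * (q.eval (t - 1) - q.eval t)).re := by
  set a := q.coeff (m + 1)
  set b := q.coeff m
  have hplus (c : ℂ) := tendsto_eval_add_sub_div hq c
  have hminus (c : ℂ) := tendsto_eval_sub_sub_div hq hm c
  have hleft := tendsto_re_conj_sub_mul_sub (hminus 1) (hplus 0) (hplus (-1)) (hplus 0)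
  have hright := tendsto_re_conj_sub_mul_sub (hminus 0) (hminus 1) (hminus 0) (hplus (-1))
  set L := (conj (-(b + (m + 1) * 1 * a) - (b + (m + 1) * 0 * a)) *
    (b + (m + 1) * -1 * a - (b + (m + 1) * 0 * a))).re with hL
  set R := (conj (-(b + (m + 1) * 0 * a) - -(b + (m + 1) * 1 * a)) *
    (-(b + (m + 1) * 0 * a) - (b + (m + 1) * -1 * a))).re with hR
  have hL_eq : L = (m + 1) ^ 2 * Complex.normSq a + 2 * (m + 1) * (conj a * b).re := by
    rw [hL, ← re_conj_mul_two_mul_add (m + 1), ← Complex.conj_re]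
    congr 1
    push_cast
    simp only [map_sub, map_add, map_neg, map_mul, map_zero, map_one, map_natCast,
      Complex.conj_conj]
    ring
  have hR_eq : R = (m + 1) ^ 2 * Complex.normSq a - 2 * (m + 1) * (conj a * b).re := by
    have h := re_conj_mul_two_mul_add (-(m + 1)) a b
    rw [neg_sq, mul_neg, neg_mul, ← sub_eq_add_neg] at h
    rw [hR, ← h]
    congr 1
    push_cast
    simp only [map_sub, map_add, map_neg, map_mul, map_zero, map_one, map_natCast]
    ring
  have hshift : 0 < 2 * ((m : ℝ) + 1) * (conj a * b).re := by positivity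
  have hnonneg : 0 ≤ ((m : ℝ) + 1) ^ 2 * Complex.normSq a :=
    mul_nonneg (by positivity) (Complex.normSq_nonneg a)
  have hR_lt : R < L := by linarith
  have hL_pos : 0 < L := by linarith
  filter_upwards [hright.eventually_lt hleft hR_lt, hleft.eventually (lt_mem_nhds hL_pos),
    eventually_ne_cobounded 0] with t hlt hleft_pos ht g hg
  have hnorm : 0 < Complex.normSq (t ^ m) := Complex.normSq_pos.mpr (pow_ne_zero m ht)
  simp only [zero_sub, add_zero, ← sub_eq_add_neg] at hlt hleft_pos
  rw [div_lt_div_iff_of_pos_right hnorm] at hlt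
  rw [div_pos_iff_of_pos_right hnorm] at hleft_pos
  rcases hg.1.eq_or_lt with rfl | hg_pos
  · rwa [zero_mul]
  · exact (mul_lt_mul_of_pos_left hlt hg_pos).trans_le (mul_le_of_le_one_left hleft_pos.le hg.2)

/-- The coefficient array `A n j` of a sequence of monic polynomials of degrees `n = 0, 1, …`
generated by Szegő's recurrence `Φ_{n+1} = z Φ_n + γ_{n+1} Φ_n^*` with `‖γ_{n+1}‖ < 1`. The
coefficients `j` range over `ℤ` to avoid truncated subtraction. -/
structure IsSzegoArray (A : ℕ → ℤ → ℂ) : Prop where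
  diag : ∀ n : ℕ, A n n = 1
  of_neg : ∀ (n : ℕ) (j : ℤ), j < 0 → A n j = 0
  step : ∀ (n : ℕ) (j : ℤ), A (n + 1) j = A n (j - 1) + A (n + 1) 0 * conj (A n (n - j))
  norm_lt : ∀ n : ℕ, ‖A (n + 1) 0‖ < 1

/-- The eigenvalue by which a differential operator with symbol `p` multiplies the `j`-th
coefficient of the polynomial of degree `n` attached to `x n`. -/
def eigenvalue (p : ℂ[X]) (n : ℕ) (j : ℤ) : ℂ :=
  (conjReflect^[n] p).eval (j - n / 2)

/-- The array satisfies, from degree `N` on, the relation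
`(D - λ) Φ_{n+1} = κ Φ_n^*` that a three-term relation for `D x_{n+1}` amounts to. -/
def IsBispectralArray (p : ℂ[X]) (N : ℕ) (A : ℕ → ℤ → ℂ) : Prop :=
  ∀ n ≥ N, ∃ κ : ℂ, ∀ j : ℤ,
    (eigenvalue p (n + 1) j - eigenvalue p (n + 1) (n + 1)) * A (n + 1) j = κ * conj (A n (n - j))

lemma conj_eigenvalue_sub (p : ℂ[X]) (n : ℕ) (j : ℤ) :
    conj (eigenvalue p n (n - j)) = eigenvalue p (n + 1) j := by
  rw [eigenvalue, eigenvalue, Function.iterate_succ_apply', eval_conjReflect]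
  congr 2
  simp only [map_sub, map_div₀, map_intCast, map_natCast, map_ofNat]
  push_cast
  ring

lemma eigenvalue_two_mul_add (p : ℂ[X]) (k ε : ℕ) (j : ℤ) :
    eigenvalue p (2 * k + ε) j = (conjReflect^[ε] p).eval (j - ((2 * k + ε : ℕ) : ℂ) / 2) := by
  rw [eigenvalue, iterate_conjReflect_two_mul_add]

section EventualInequalities

variable {p : ℂ[X]}

lemma tendsto_two_mul_add_atTop (ε : ℕ) : Tendsto (fun k : ℕ => 2 * k + ε) atTop atTop :=
  tendsto_atTop_mono (fun k => (by omega : k ≤ 2 * k + ε)) tendsto_id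

lemma eventually_eigenvalue_ne_top {ε : ℕ} {j : ℤ}
    (h : ¬ IsReflectionInvariant (conjReflect^[ε] p) j) :
    ∀ᶠ k : ℕ in atTop,
      eigenvalue p (2 * k + ε) j ≠ eigenvalue p (2 * k + ε) (2 * k + ε : ℕ) := by
  filter_upwards [(tendsto_natCast_div_two_cobounded.comp (tendsto_two_mul_add_atTop ε)).eventually
    (eventually_eval_sub_ne h)] with k hk
  simpa [eigenvalue_two_mul_add, sub_half] using hk

lemma eventually_eigenvalue_add_ne_top (hp : 0 < p.natDegree) {d : ℤ} (hd : d ≠ 0) :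
    ∀ᶠ n : ℕ in atTop, eigenvalue p n (n + d) ≠ eigenvalue p n n := by
  have h := eventually_iterate_conjReflect (p := p)
    (P := fun q t => q.eval (t + d) ≠ q.eval t)
    fun q hq => eventually_eval_add_ne (hq ▸ hp) (Int.cast_ne_zero.mpr hd)
  filter_upwards [h] with n hn
  have hhalf : (n : ℂ) / 2 + d = (n + d : ℤ) - (n : ℂ) / 2 := by push_cast; ring
  have hhalf' : (n : ℂ) / 2 = (n : ℤ) - (n : ℂ) / 2 := by push_cast; ring
  rw [eigenvalue, eigenvalue, ← hhalf, ← hhalf']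
  exact hn

end EventualInequalities

section Arrays

variable {p : ℂ[X]} {N : ℕ} {A : ℕ → ℤ → ℂ}

namespace IsSzegoArray

lemma subdiag_succ (hA : IsSzegoArray A) (n : ℕ) :
    A (n + 1) n = A n (n - 1) + A (n + 1) 0 * conj (A n 0) := by
  rw [hA.step n n, sub_self]

lemma coeff_one (hA : IsSzegoArray A) (n : ℕ) :
    A (n + 1) 1 = A n 0 + A (n + 1) 0 * conj (A n (n - 1)) := by
  rw [hA.step n 1, sub_self]

lemma norm_coeff_zero_le (hA : IsSzegoArray A) (n : ℕ) : ‖A n 0‖ ≤ 1 := by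
  cases n with
  | zero => simpa using (congrArg norm (hA.diag 0)).le
  | succ n => exact (hA.norm_lt n).le

lemma norm_subdiag_le (hA : IsSzegoArray A) (n : ℕ) : ‖A n (n - 1)‖ ≤ n := by
  induction n with
  | zero => simp [hA.of_neg 0 (-1) (by norm_num)]
  | succ n ih =>
    have hprod : ‖A (n + 1) 0 * conj (A n 0)‖ ≤ 1 := by
      rw [norm_mul, RCLike.norm_conj]
      exact mul_le_one₀ (hA.norm_lt n).le (norm_nonneg _) (hA.norm_coeff_zero_le n)
    push_cast
    rw [add_sub_cancel_right, hA.subdiag_succ]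
    exact (norm_add_le _ _).trans (add_le_add ih hprod)

end IsSzegoArray

namespace IsBispectralArray

lemma relation (hB : IsBispectralArray p N A) (hA : IsSzegoArray A) {n : ℕ} (hn : N ≤ n) (j : ℤ) :
    (eigenvalue p (n + 1) j - eigenvalue p (n + 1) (n + 1)) * A (n + 1) j =
      (eigenvalue p (n + 1) 0 - eigenvalue p (n + 1) (n + 1)) * A (n + 1) 0 *
        conj (A n (n - j)) := by
  obtain ⟨κ, hκ⟩ := hB n hn
  have hκ_eq := hκ 0
  rw [sub_zero, hA.diag, map_one, mul_one] at hκ_eq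
  rw [hκ, hκ_eq]

lemma eq_zero_of_coeff_zero_eq_zero (hB : IsBispectralArray p N A) (hA : IsSzegoArray A) {n : ℕ}
    (hn : N ≤ n) (hzero : A (n + 1) 0 = 0) {j : ℤ}
    (hj : eigenvalue p (n + 1) j ≠ eigenvalue p (n + 1) (n + 1)) : A (n + 1) j = 0 := by
  have h := hB.relation hA hn j
  rw [hzero, mul_zero, zero_mul] at h
  exact (mul_eq_zero.mp h).resolve_left (sub_ne_zero.mpr hj)

lemma subdiag_relation (hB : IsBispectralArray p N A) (hA : IsSzegoArray A) {n : ℕ} (hn : N ≤ n) :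
    (eigenvalue p (n + 1) n - eigenvalue p (n + 1) (n + 1)) * A n (n - 1) =
      (eigenvalue p (n + 1) 0 - eigenvalue p (n + 1) n) * A (n + 1) 0 * conj (A n 0) := by
  have h := hB.relation hA hn n
  rw [hA.subdiag_succ, sub_self] at h
  linear_combination h

lemma subdiag_succ_mul (hB : IsBispectralArray p N A) (hA : IsSzegoArray A) {n : ℕ} (hn : N ≤ n) :
    A (n + 1) n * (eigenvalue p (n + 1) 0 - eigenvalue p (n + 1) n) =
      A n (n - 1) * (eigenvalue p (n + 1) 0 - eigenvalue p (n + 1) (n + 1)) := by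
  rw [hA.subdiag_succ]
  linear_combination -hB.subdiag_relation hA hn

lemma coeff_zero_relation (hB : IsBispectralArray p N A) (hA : IsSzegoArray A) {n : ℕ}
    (hn : N ≤ n) :
    (eigenvalue p (n + 1) 1 - eigenvalue p (n + 1) (n + 1)) * A n 0 =
      (eigenvalue p (n + 1) 0 - eigenvalue p (n + 1) 1) * A (n + 1) 0 * conj (A n (n - 1)) := by
  have h := hB.relation hA hn 1
  rw [hA.coeff_one] at h
  linear_combination h

lemma normSq_relation (hB : IsBispectralArray p N A) (hA : IsSzegoArray A) {n : ℕ} (hn : N ≤ n)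
    (hsub : A n (n - 1) ≠ 0) :
    conj (eigenvalue p (n + 1) 1 - eigenvalue p (n + 1) (n + 1)) *
        (eigenvalue p (n + 1) n - eigenvalue p (n + 1) (n + 1)) =
      Complex.normSq (A (n + 1) 0) * (conj (eigenvalue p (n + 1) 0 - eigenvalue p (n + 1) 1) *
        (eigenvalue p (n + 1) 0 - eigenvalue p (n + 1) n)) := by
  have hconj := congrArg conj (hB.coeff_zero_relation hA hn)
  simp only [map_mul, Complex.conj_conj] at hconj
  refine mul_right_cancel₀ hsub ?_
  rw [Complex.normSq_eq_conj_mul_self]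
  linear_combination
    conj (eigenvalue p (n + 1) 1 - eigenvalue p (n + 1) (n + 1)) * hB.subdiag_relation hA hn +
      (eigenvalue p (n + 1) 0 - eigenvalue p (n + 1) n) * A (n + 1) 0 * hconj

end IsBispectralArray

end Arrays

/-! ### Vanishing of the subdiagonal -/

section Subdiagonal

variable {p : ℂ[X]} {N : ℕ} {A : ℕ → ℤ → ℂ}

namespace IsBispectralArray

/-- If the subdiagonal entry is nonzero, `normSq_relation` gives `1 = ‖γ_{n+1}‖ ^ 2`. -/
lemma subdiag_eq_zero_of_natDegree_eq_one (hB : IsBispectralArray p N A) (hA : IsSzegoArray A)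
    (hp : p.natDegree = 1) {n : ℕ} (hn : N ≤ n) (hn_pos : 0 < n) : A n (n - 1) = 0 := by
  by_contra hsub
  have hnormSq := hB.normSq_relation hA hn hsub
  set q := conjReflect^[n + 1] p
  have hq : q.natDegree = 1 := (natDegree_iterate_conjReflect p _).trans hp
  have hlead : q.coeff 1 ≠ 0 := by
    rw [← hq, coeff_natDegree, leadingCoeff_ne_zero]
    exact ne_zero_of_natDegree_gt (n := 0) (by omega)
  have heval (t : ℂ) : q.eval t = q.coeff 1 * t + q.coeff 0 := by
    conv_lhs => rw [eq_X_add_C_of_natDegree_le_one hq.le]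
    simp
  have hdiff (i j : ℤ) :
      eigenvalue p (n + 1) i - eigenvalue p (n + 1) j = q.coeff 1 * (i - j) := by
    rw [eigenvalue, eigenvalue, heval, heval]
    ring
  have hfactor : (n : ℂ) * (conj (q.coeff 1) * q.coeff 1) ≠ 0 :=
    mul_ne_zero (Nat.cast_ne_zero.mpr hn_pos.ne')
      (mul_ne_zero (star_ne_zero.mpr hlead) hlead)
  have hone : (Complex.normSq (A (n + 1) 0) : ℂ) = 1 := by
    refine mul_right_cancel₀ hfactor ?_
    simp only [hdiff, map_mul, map_sub, map_intCast] at hnormSq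
    push_cast at hnormSq
    linear_combination -hnormSq
  have hlt := hA.norm_lt n
  rw [Complex.ofReal_eq_one, Complex.normSq_eq_norm_sq] at hone
  nlinarith [norm_nonneg (A (n + 1) 0)]

lemma eventually_subdiag_eq_zero_of_even (hB : IsBispectralArray p N A) (hA : IsSzegoArray A)
    (hp : 0 < p.natDegree) (hp_even : Even p.natDegree) :
    ∃ ε : ℕ, ∀ᶠ k : ℕ in atTop, A (2 * k + ε) ((2 * k + ε : ℕ) - 1) = 0 := by
  obtain ⟨m, hm⟩ := Nat.exists_eq_add_one.mpr hp
  have hm_odd : Odd m := by rwa [hm, Nat.even_add_one, Nat.not_even_iff_odd] at hp_even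
  obtain ⟨ε, hε⟩ := exists_iterate_conjReflect_re_pos hm hm_odd
  have hdeg : (conjReflect^[ε + 1] p).natDegree ≤ m + 1 :=
    ((natDegree_iterate_conjReflect p _).trans hm).le
  refine ⟨ε, ?_⟩
  filter_upwards [eventually_ge_atTop N,
    (tendsto_natCast_div_two_cobounded.comp (tendsto_two_mul_add_atTop (ε + 1))).eventually
      (eventually_mul_re_lt_re hdeg hm_odd hε)] with k hk hlt
  by_contra hsub
  have hnormSq_le : Complex.normSq (A (2 * k + ε + 1) 0) ≤ 1 := by
    rw [Complex.normSq_eq_norm_sq]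
    exact pow_le_one₀ (norm_nonneg _) (hA.norm_lt _).le
  refine (hlt _ ⟨Complex.normSq_nonneg _, hnormSq_le⟩).ne' ?_
  have hrelation := congrArg Complex.re (hB.normSq_relation hA (by omega) hsub)
  have heval (j : ℤ) : eigenvalue p (2 * k + ε + 1) j =
      (conjReflect^[ε + 1] p).eval (j - ((2 * k + (ε + 1) : ℕ) : ℂ) / 2) :=
    eigenvalue_two_mul_add p k (ε + 1) j
  set h : ℂ := ((2 * k + (ε + 1) : ℕ) : ℂ) / 2 with hh
  have hbelow : (((2 * k + ε : ℕ) : ℤ) : ℂ) - h = h - 1 := by rw [hh]; push_cast; ring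
  have htop : ((((2 * k + ε : ℕ) : ℤ) + 1 : ℤ) : ℂ) - h = h := by rw [hh]; push_cast; ring
  simp only [heval, hbelow, htop, Int.cast_one, Int.cast_zero, zero_sub,
    Complex.re_ofReal_mul] at hrelation
  exact hrelation

end IsBispectralArray

/-- The distance between the eigenvalues of the extreme coefficients in degree `n`. -/
def eigenvalueGap (p : ℂ[X]) (n : ℕ) : ℝ :=
  ‖eigenvalue p n 0 - eigenvalue p n n‖

lemma eventually_eigenvalueGap_ne_zero (hp : Odd p.natDegree) :
    ∀ᶠ n in atTop, eigenvalueGap p n ≠ 0 := by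
  have h := eventually_iterate_conjReflect (p := p) (P := fun q t => q.eval (0 - t) ≠ q.eval t)
    fun q hq => eventually_eval_sub_ne fun hinv => Nat.not_even_iff_odd.mpr (hq ▸ hp)
      hinv.even_natDegree
  filter_upwards [h] with n hn
  rw [eigenvalueGap, norm_ne_zero_iff, sub_ne_zero]
  simpa [eigenvalue, sub_half] using hn

lemma tendsto_eigenvalueGap_two_mul_div (hp : Odd p.natDegree) (hp_one : p.natDegree ≠ 1) :
    Tendsto (fun k : ℕ => eigenvalueGap p (2 * k) / k) atTop atTop := by
  set r := p.comp (-X) - p with hr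
  have hr_zero : r.coeff 0 = 0 := by simp [hr, coeff_zero_eq_eval_zero]
  have hr_lead : r.coeff p.natDegree ≠ 0 := by
    have hlead : p.leadingCoeff ≠ 0 := leadingCoeff_ne_zero.mpr fun h => by simp [h] at hp
    rw [hr, coeff_sub, neg_eq_neg_one_mul, ← C_1, ← C_neg, comp_C_mul_X_coeff, hp.neg_one_pow,
      mul_neg_one, coeff_natDegree, sub_ne_zero]
    exact neg_ne_self.mpr hlead
  have hdeg : 0 < r.divX.degree := by
    rw [← natDegree_pos_iff_degree_pos, natDegree_divX_eq_natDegree_tsub_one]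
    have := le_natDegree_of_ne_zero hr_lead
    have := hp.pos
    omega
  have htop := r.divX.tendsto_norm_atTop hdeg (tendsto_norm_cobounded_atTop.comp
    (tendsto_natCast_atTop_cobounded (α := ℂ)))
  refine htop.congr' ?_
  filter_upwards [eventually_ne_atTop 0] with k hk
  have heval : r.eval (k : ℂ) = r.divX.eval (k : ℂ) * k := by
    conv_lhs => rw [← divX_mul_X_add r, hr_zero]
    simp
  have hgap : eigenvalueGap p (2 * k) = ‖r.eval (k : ℂ)‖ := by
    rw [eigenvalueGap, ← add_zero (2 * k), eigenvalue_two_mul_add, eigenvalue_two_mul_add]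
    have hhalf : ((2 * k + 0 : ℕ) : ℂ) / 2 = k := by
      push_cast
      ring
    have htop : ((2 * k + 0 : ℕ) : ℤ) - (k : ℂ) = k := by
      push_cast
      ring
    rw [hhalf, htop, Int.cast_zero, zero_sub, Function.iterate_zero, id, hr, eval_sub, eval_comp,
      eval_neg, eval_X]
  rw [hgap, heval, norm_mul, Complex.norm_natCast,
    mul_div_cancel_right₀ _ (Nat.cast_ne_zero.mpr hk)]

namespace IsBispectralArray

lemma norm_subdiag_succ_mul (hB : IsBispectralArray p N A) (hA : IsSzegoArray A) {n : ℕ}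
    (hn : N ≤ n) :
    ‖A (n + 1) n‖ * eigenvalueGap p n = ‖A n (n - 1)‖ * eigenvalueGap p (n + 1) := by
  have hbottom : eigenvalue p (n + 1) 0 = conj (eigenvalue p n n) := by
    rw [← conj_eigenvalue_sub, sub_zero]
  have htop : eigenvalue p (n + 1) n = conj (eigenvalue p n 0) := by
    rw [← conj_eigenvalue_sub, sub_self]
  have h := congrArg norm (hB.subdiag_succ_mul hA hn)
  rw [norm_mul, norm_mul, hbottom, htop, ← map_sub, RCLike.norm_conj, norm_sub_rev, ← hbottom] at h
  exact_mod_cast h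

lemma norm_subdiag_mul_eigenvalueGap (hB : IsBispectralArray p N A) (hA : IsSzegoArray A) {K : ℕ}
    (hK : N ≤ K) (hgap : ∀ n ≥ K, eigenvalueGap p n ≠ 0) {n : ℕ} (hn : K ≤ n) :
    ‖A n (n - 1)‖ * eigenvalueGap p K = ‖A K (K - 1)‖ * eigenvalueGap p n := by
  induction n, hn using Nat.le_induction with
  | base => rfl
  | succ n hn ih =>
    have hstep := hB.norm_subdiag_succ_mul hA (hK.trans hn)
    refine mul_right_cancel₀ (hgap n hn) ?_
    push_cast
    rw [add_sub_cancel_right]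
    linear_combination eigenvalueGap p K * hstep + eigenvalueGap p (n + 1) * ih

/-- The subdiagonal entries grow at most linearly, whereas they are proportional to
`eigenvalueGap p`, which grows faster. -/
lemma eventually_subdiag_eq_zero_of_odd (hB : IsBispectralArray p N A) (hA : IsSzegoArray A)
    (hp : Odd p.natDegree) (hp_one : p.natDegree ≠ 1) : ∀ᶠ n : ℕ in atTop, A n (n - 1) = 0 := by
  filter_upwards [eventually_forall_ge_atTop.mpr (eventually_eigenvalueGap_ne_zero hp),
    eventually_ge_atTop N] with K hgap hK
  by_contra hsub
  have hlim := (tendsto_eigenvalueGap_two_mul_div hp hp_one).const_mul_atTop (norm_pos_iff.mpr hsub)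
  obtain ⟨k, hlt, hKk⟩ :=
    ((hlim.eventually_gt_atTop (2 * eigenvalueGap p K)).and (eventually_gt_atTop K)).exists
  have hk : (0 : ℝ) < k := Nat.cast_pos.mpr (by omega)
  have hbound : ‖A K (K - 1)‖ * eigenvalueGap p (2 * k) ≤ (2 * k : ℕ) * eigenvalueGap p K := by
    rw [← hB.norm_subdiag_mul_eigenvalueGap hA hK hgap (by omega)]
    exact mul_le_mul_of_nonneg_right (hA.norm_subdiag_le _) (norm_nonneg _)
  rw [← mul_div_assoc, lt_div_iff₀ hk] at hlt
  push_cast at hbound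
  linarith

lemma exists_eventually_subdiag_eq_zero (hB : IsBispectralArray p N A) (hA : IsSzegoArray A)
    (hp : 0 < p.natDegree) :
    ∃ ε : ℕ, ∀ᶠ k : ℕ in atTop, A (2 * k + ε) ((2 * k + ε : ℕ) - 1) = 0 := by
  rcases p.natDegree.even_or_odd with heven | hodd
  · exact hB.eventually_subdiag_eq_zero_of_even hA hp heven
  have hall : ∀ᶠ n : ℕ in atTop, A n (n - 1) = 0 := by
    by_cases hone : p.natDegree = 1
    · filter_upwards [eventually_ge_atTop N, eventually_gt_atTop 0] with n hn hn_pos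
      exact hB.subdiag_eq_zero_of_natDegree_eq_one hA hone hn hn_pos
    · exact hB.eventually_subdiag_eq_zero_of_odd hA hodd hone
  exact ⟨0, (tendsto_two_mul_add_atTop 0).eventually hall⟩

end IsBispectralArray

end Subdiagonal

/-! ### Vanishing of the Verblunsky coefficients -/

section Vanishing

variable {p : ℂ[X]} {N : ℕ} {A : ℕ → ℤ → ℂ}

namespace IsBispectralArray

lemma eventually_coeff_zero_eq_zero_of_subdiag (hB : IsBispectralArray p N A) (hA : IsSzegoArray A)
    {ε : ℕ} (hsub : ∀ᶠ k : ℕ in atTop, A (2 * k + ε) ((2 * k + ε : ℕ) - 1) = 0)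
    (hsymm : ¬ IsReflectionInvariant (conjReflect^[ε + 1] p) 1) :
    ∀ᶠ k : ℕ in atTop, A (2 * k + ε) 0 = 0 := by
  rw [← Int.cast_one] at hsymm
  filter_upwards [hsub, eventually_eigenvalue_ne_top hsymm, eventually_ge_atTop N]
    with k hsub hne hk
  have h := hB.coeff_zero_relation hA (by omega : N ≤ 2 * k + ε)
  rw [hsub, map_zero, mul_zero] at h
  exact (mul_eq_zero.mp h).resolve_left (sub_ne_zero.mpr (mod_cast hne))

lemma eventually_subdiag_succ_eq_zero (hB : IsBispectralArray p N A) (hA : IsSzegoArray A)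
    {ε : ℕ} (hsub : ∀ᶠ k : ℕ in atTop, A (2 * k + ε) ((2 * k + ε : ℕ) - 1) = 0)
    (hsymm : ¬ IsReflectionInvariant (conjReflect^[ε] p) 0) :
    ∀ᶠ k : ℕ in atTop, A (2 * k + (ε + 1)) ((2 * k + (ε + 1) : ℕ) - 1) = 0 := by
  rw [← Int.cast_zero] at hsymm
  filter_upwards [hsub, eventually_eigenvalue_ne_top hsymm, eventually_ge_atTop N]
    with k hsub hne hk
  have h := hB.norm_subdiag_succ_mul hA (by omega : N ≤ 2 * k + ε)
  rw [hsub, norm_zero, zero_mul] at h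
  have hgap : eigenvalueGap p (2 * k + ε) ≠ 0 := norm_ne_zero_iff.mpr (sub_ne_zero.mpr hne)
  have hzero := norm_eq_zero.mp ((mul_eq_zero.mp h).resolve_right hgap)
  rw [← add_assoc]
  push_cast at hzero ⊢
  rwa [add_sub_cancel_right]

lemma eventually_coeff_zero_succ_of_not_symmetric (hB : IsBispectralArray p N A)
    (hA : IsSzegoArray A) {ε : ℕ} (hzero : ∀ᶠ k : ℕ in atTop, A (2 * k + ε) 0 = 0)
    (hsymm : ¬ IsReflectionInvariant (conjReflect^[ε] p) 1) :
    ∀ᶠ k : ℕ in atTop, A (2 * k + (ε + 1)) 0 = 0 := by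
  rw [← Int.cast_one] at hsymm
  have hnext := tendsto_add_atTop_nat 1
  filter_upwards [hnext.eventually hzero, hnext.eventually (eventually_eigenvalue_ne_top hsymm),
    eventually_ge_atTop N] with k hzero hne hk
  have hindex : 2 * (k + 1) + ε = 2 * k + (ε + 1) + 1 := by ring
  rw [hindex] at hzero hne
  have h := hB.eq_zero_of_coeff_zero_eq_zero hA (by omega) hzero (mod_cast hne)
  rwa [hA.coeff_one, hzero, zero_mul, add_zero] at h

lemma eventually_coeff_zero_succ_of_symmetric (hB : IsBispectralArray p N A)
    (hA : IsSzegoArray A) (hp : 0 < p.natDegree) {ε : ℕ}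
    (hzero : ∀ᶠ k : ℕ in atTop, A (2 * k + ε) 0 = 0)
    (hsymm : IsReflectionInvariant (conjReflect^[ε] p) 1) :
    ∀ᶠ k : ℕ in atTop, A (2 * k + (ε + 1)) 0 = 0 := by
  have hsymm_three : ¬ IsReflectionInvariant (conjReflect^[ε] p) (3 : ℤ) := fun h => by
    have := hsymm.eq (by rwa [natDegree_iterate_conjReflect]) h
    norm_num at this
  have hne_two := eventually_eigenvalue_add_ne_top hp (by norm_num : (-2 : ℤ) ≠ 0)
  filter_upwards [(tendsto_add_atTop_nat 1).eventually hzero,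
    (tendsto_add_atTop_nat 2).eventually hzero,
    (tendsto_add_atTop_nat 2).eventually (eventually_eigenvalue_ne_top hsymm_three),
    (tendsto_two_mul_add_atTop (ε + 2)).eventually hne_two, eventually_ge_atTop N]
    with k hzero_one hzero_three hne_three hne_two hk
  set n := 2 * k + (ε + 1) with hn
  have hindex_one : 2 * (k + 1) + ε = n + 1 := by omega
  have hindex_two : 2 * k + (ε + 2) = n + 1 := by omega
  have hindex_three : 2 * (k + 2) + ε = n + 2 + 1 := by omega
  rw [hindex_one] at hzero_one
  rw [hindex_two] at hne_two
  rw [hindex_three] at hzero_three hne_three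
  push_cast at hne_two hne_three
  have hbelow : A (n + 1) (n - 1) = 0 := by
    refine hB.eq_zero_of_coeff_zero_eq_zero hA (by omega) hzero_one ?_
    convert hne_two using 2
    ring
  have hthree : A (n + 2 + 1) 3 = 0 :=
    hB.eq_zero_of_coeff_zero_eq_zero hA (by omega) hzero_three (mod_cast hne_three)
  have htwo : A (n + 2) 2 = 0 := by
    simpa [hA.step (n + 2) 3, hzero_three] using hthree
  have hone : A (n + 1) 1 = 0 := by
    have h := hA.step (n + 1) 2
    push_cast at h
    rw [add_sub_assoc] at h
    simpa [htwo, ← sub_eq_add_neg, hbelow] using h.symm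
  rwa [hA.coeff_one, hzero_one, zero_mul, add_zero] at hone

lemma exists_eventually_coeff_zero_eq_zero (hB : IsBispectralArray p N A) (hA : IsSzegoArray A)
    (hp : 0 < p.natDegree) : ∃ ε : ℕ, ∀ᶠ k : ℕ in atTop, A (2 * k + ε) 0 = 0 := by
  obtain ⟨ε, hsub⟩ := hB.exists_eventually_subdiag_eq_zero hA hp
  by_cases hsymm : IsReflectionInvariant (conjReflect^[ε + 1] p) 1
  · have hsymm' : IsReflectionInvariant (conjReflect^[ε] p) (-1 - conj (1 : ℂ)) := by
      rw [Function.iterate_succ_apply'] at hsymm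
      exact hsymm.of_conjReflect
    have hnot : ∀ c : ℂ, c ≠ -1 - conj (1 : ℂ) →
        ¬ IsReflectionInvariant (conjReflect^[ε] p) c := fun c hc h =>
      hc (h.eq (by rwa [natDegree_iterate_conjReflect]) hsymm')
    refine ⟨ε + 1, hB.eventually_coeff_zero_eq_zero_of_subdiag hA
      (hB.eventually_subdiag_succ_eq_zero hA hsub (hnot 0 (by norm_num))) ?_⟩
    rw [Function.iterate_succ_apply', Function.iterate_succ_apply', conjReflect_involutive]
    exact hnot 1 (by norm_num)
  · exact ⟨ε, hB.eventually_coeff_zero_eq_zero_of_subdiag hA hsub hsymm⟩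

lemma eventually_coeff_zero_eq_zero (hB : IsBispectralArray p N A) (hA : IsSzegoArray A)
    (hp : 0 < p.natDegree) : ∀ᶠ n in atTop, A n 0 = 0 := by
  obtain ⟨ε, hzero⟩ := hB.exists_eventually_coeff_zero_eq_zero hA hp
  have hzero_succ : ∀ᶠ k : ℕ in atTop, A (2 * k + (ε + 1)) 0 = 0 := by
    by_cases hsymm : IsReflectionInvariant (conjReflect^[ε] p) 1
    · exact hB.eventually_coeff_zero_succ_of_symmetric hA hp hzero hsymm
    · exact hB.eventually_coeff_zero_succ_of_not_symmetric hA hzero hsymm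
  obtain ⟨K, hK⟩ := eventually_atTop.mp (hzero.and hzero_succ)
  refine eventually_atTop.mpr ⟨2 * K + ε, fun n hn => ?_⟩
  obtain ⟨k, hk | hk⟩ : ∃ k, n = 2 * k + ε ∨ n = 2 * k + (ε + 1) := ⟨(n - ε) / 2, by omega⟩
  · exact hk ▸ (hK k (by omega)).1
  · exact hk ▸ (hK k (by omega)).2

/-- Once the constant coefficients vanish, Szegő's recurrence only shifts the array along its
diagonals, so an entry off the main diagonal can be killed arbitrarily far down. -/
lemma eventually_eq_ite (hB : IsBispectralArray p N A) (hA : IsSzegoArray A)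
    (hp : 0 < p.natDegree) : ∀ᶠ n : ℕ in atTop, ∀ j : ℤ, A n j = if j = n then 1 else 0 := by
  filter_upwards [eventually_forall_ge_atTop.mpr (hB.eventually_coeff_zero_eq_zero hA hp)]
    with n hzero j
  split_ifs with hj
  · rw [hj, hA.diag]
  have hshift : ∀ d : ℕ, A (n + d) (j + d) = A n j := fun d => by
    induction d with
    | zero => simp
    | succ d ih =>
      rw [← add_assoc, hA.step, hzero (n + d + 1) (by omega), zero_mul, add_zero, ← ih]
      push_cast
      rw [← add_assoc, add_sub_cancel_right]
  obtain ⟨m, hne, hm⟩ := ((eventually_eigenvalue_add_ne_top hp (sub_ne_zero.mpr hj)).and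
    (eventually_gt_atTop (max n N))).exists
  obtain ⟨d, rfl⟩ : ∃ d, m = n + d + 1 := ⟨m - n - 1, by omega⟩
  have hindex : ((n + d + 1 : ℕ) + (j - n) : ℤ) = j + (d + 1 : ℕ) := by
    push_cast
    ring
  rw [hindex] at hne
  rw [← hshift (d + 1)]
  exact hB.eq_zero_of_coeff_zero_eq_zero hA (by omega) (hzero (n + d + 1) (by omega)) hne

theorem eq_ite (hB : IsBispectralArray p N A) (hA : IsSzegoArray A) (hp : 0 < p.natDegree)
    (n : ℕ) (j : ℤ) : A n j = if j = n then 1 else 0 := by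
  obtain ⟨K, hK, hnK⟩ := ((hB.eventually_eq_ite hA hp).and (eventually_ge_atTop n)).exists
  induction hnK using Nat.decreasingInduction generalizing j with
  | self => exact hK j
  | of_succ n _ ih =>
    have hzero : A (n + 1) 0 = 0 := (ih 0).trans (if_neg (by omega))
    have h := hA.step n (j + 1)
    rw [hzero, zero_mul, add_zero, add_sub_cancel_right, ih] at h
    simpa using h.symm

end IsBispectralArray

end Vanishing

/-! ### Laurent polynomials and differential operators -/

section LaurentPolynomials

open LaurentPolynomial (T)

lemma coeff_mul_T (f : ℂ[T;T⁻¹]) (n i : ℤ) : (f * T n).coeff i = f.coeff (i - n) := by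
  rw [T, AddMonoidAlgebra.coeff_mul_single_eq_coeff_mul (i - n), mul_one]
  exact fun m _ => ⟨eq_sub_of_add_eq, add_eq_of_eq_sub⟩

lemma ev_T (z : ℂˣ) (n : ℤ) : ev z (T n) = (z : ℂ) ^ n := by
  simp [ev]

lemma ev_smul (z : ℂˣ) (c : ℂ) (f : ℂ[T;T⁻¹]) : ev z (c • f) = c * ev z f := by
  simp [ev, LaurentPolynomial.smul_eq_C_mul]

lemma ev_toLaurent (z : ℂˣ) (q : ℂ[X]) : ev z (toLaurent q) = q.eval (z : ℂ) := by
  simp [ev]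

/-- The Laurent polynomial `f` as a function on `ℂ ∖ {0}`. -/
def evLinear : ℂ[T;T⁻¹] →ₗ[ℂ] (ℂˣ → ℂ) where
  toFun f z := ev z f
  map_add' f g := funext fun z => map_add (ev z) f g
  map_smul' c f := funext fun z => ev_smul z c f

lemma evLinear_injective : Function.Injective evLinear := by
  refine (injective_iff_map_eq_zero evLinear).mpr fun f hf => ?_
  obtain ⟨n, q, hq⟩ := f.exists_T_pow
  have hroot : ∀ z : ℂˣ, q.IsRoot z := fun z => by
    rw [IsRoot, ← ev_toLaurent, hq, map_mul, show ev z f = 0 from congrFun hf z, zero_mul]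
  have hq_zero : q = 0 := Polynomial.eq_zero_of_infinite_isRoot q <|
    (Set.finite_singleton (0 : ℂ)).infinite_compl.mono fun z hz => hroot (Units.mk0 z hz)
  rw [hq_zero, map_zero] at hq
  exact (LaurentPolynomial.isUnit_T (n : ℤ)).mul_left_eq_zero.mp hq.symm

lemma coeff_ddz (f : ℂ[T;T⁻¹]) (i : ℤ) : (ddz f).coeff i = (i + 1) * f.coeff (i + 1) := by
  simp only [ddz, ← LaurentPolynomial.smul_eq_C_mul, Finsupp.sum, AddMonoidAlgebra.coeff_sum,
    Finsupp.finsetSum_apply, AddMonoidAlgebra.coeff_smul, Finsupp.smul_apply, smul_eq_mul,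
    LaurentPolynomial.T_apply]
  rw [Finset.sum_eq_single (i + 1)]
  · simp
  · intro b _ hb
    rw [if_neg (by omega), mul_zero]
  · intro hsupp
    simp [Finsupp.notMem_support_iff.mp hsupp]

lemma ddz_smul (c : ℂ) (f : ℂ[T;T⁻¹]) : ddz (c • f) = c • ddz f := by
  ext i
  simp only [coeff_ddz, AddMonoidAlgebra.coeff_smul, Finsupp.smul_apply, smul_eq_mul]
  ring

lemma ddz_T (j : ℤ) : ddz (T j) = (j : ℂ) • T (j - 1) := by
  ext i
  simp only [coeff_ddz, AddMonoidAlgebra.coeff_smul, Finsupp.smul_apply, smul_eq_mul,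
    LaurentPolynomial.T_apply, sub_eq_iff_eq_add]
  split_ifs with h
  · simp [h]
  · simp

lemma ddz_iterate_T (k : ℕ) (j : ℤ) :
    ddz^[k] (T j : ℂ[T;T⁻¹]) = (descPochhammer ℂ k).eval (j : ℂ) • T (j - k) := by
  induction k with
  | zero => simp
  | succ k ih =>
    rw [Function.iterate_succ_apply', ih, ddz_smul, ddz_T, smul_smul, descPochhammer_succ_eval,
      sub_sub]
    push_cast
    rfl

end LaurentPolynomials

section Symbol

open LaurentPolynomial (T)

variable {r : ℕ} {D : ℂ[T;T⁻¹] →ₗ[ℂ] ℂ[T;T⁻¹]}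

/-- Evaluation at `j = k` leaves only the terms up to `k`, so the system is triangular with
diagonal entries `k!`. -/
lemma mem_of_forall_sum_descPochhammer_smul_mem {K M : Type*} [Field K] [CharZero K]
    [AddCommGroup M] [Module K M] {W : Submodule K M} {b : ℕ → M}
    (h : ∀ j : ℕ, ∑ k ∈ Finset.range r, (descPochhammer K k).eval (j : K) • b k ∈ W)
    {k : ℕ} (hk : k < r) : b k ∈ W := by
  induction k using Nat.strong_induction_on with
  | _ k ih =>
    have hsub : Finset.range (k + 1) ⊆ Finset.range r := Finset.range_subset_range.mpr hk
    have hvanish : ∀ i ∈ Finset.range r, i ∉ Finset.range (k + 1) →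
        (descPochhammer K i).eval (k : K) • b i = 0 := fun i _ hi => by
      rw [Finset.mem_range, not_lt] at hi
      rw [descPochhammer_eval_coe_nat_of_lt hi, zero_smul]
    have hk_mem := h k
    rw [← Finset.sum_subset hsub hvanish, Finset.sum_range_succ] at hk_mem
    have hlow := W.sum_mem fun i hi =>
      W.smul_mem ((descPochhammer K i).eval (k : K))
        (ih i (Finset.mem_range.mp hi) ((Finset.mem_range.mp hi).trans hk))
    have hterm := (W.add_mem_iff_right hlow).mp hk_mem
    rw [descPochhammer_eval_eq_descFactorial, Nat.descFactorial_self] at hterm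
    exact (W.smul_mem_iff (Nat.cast_ne_zero.mpr k.factorial_ne_zero)).mp hterm

lemma evLinear_map_T_mul_T_neg {a : ℕ → ℂˣ → ℂ}
    (h : ∀ (f : ℂ[T;T⁻¹]) (z : ℂˣ),
      ev z (D f) = ∑ k ∈ Finset.range (r + 1), a k z * ev z (ddz^[k] f)) (j : ℤ) :
    evLinear (D (T j) * T (-j)) = ∑ k ∈ Finset.range (r + 1),
      (descPochhammer ℂ k).eval (j : ℂ) • fun z : ℂˣ => a k z * (z : ℂ) ^ (-(k : ℤ)) := by
  ext z
  rw [Finset.sum_apply]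
  change ev z (D (T j) * T (-j)) = _
  rw [map_mul, h, Finset.sum_mul]
  refine Finset.sum_congr rfl fun k _ => ?_
  have hpow : (z : ℂ) ^ (j - k) * (z : ℂ) ^ (-j) = (z : ℂ) ^ (-(k : ℤ)) := by
    rw [← zpow_add₀ z.ne_zero]
    ring_nf
  rw [ddz_iterate_T, ev_smul, ev_T, ev_T, Pi.smul_apply, smul_eq_mul, ← hpow]
  ring

/-- Here `B k` is `z⁻ᵏ` times the coefficient of `dᵏ/dzᵏ` in `D`. -/
lemma IsDiffOp.exists_map_T (hD : IsDiffOp r D) :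
    ∃ B : ℕ → ℂ[T;T⁻¹], B r ≠ 0 ∧ ∀ j : ℤ, D (T j) * T (-j) =
      ∑ k ∈ Finset.range (r + 1), (descPochhammer ℂ k).eval (j : ℂ) • B k := by
  obtain ⟨a, ha, h⟩ := hD
  have hmem : ∀ k < r + 1, (fun z : ℂˣ => a k z * (z : ℂ) ^ (-(k : ℤ))) ∈
      LinearMap.range evLinear := fun k hk => by
    refine mem_of_forall_sum_descPochhammer_smul_mem (W := LinearMap.range evLinear)
      (b := fun k z => a k z * (z : ℂ) ^ (-(k : ℤ))) (fun j => ⟨D (T j) * T (-j), ?_⟩) hk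
    simpa only [Int.cast_natCast] using evLinear_map_T_mul_T_neg h j
  choose! B hB using hmem
  refine ⟨B, fun hzero => ha (funext fun z => ?_), fun j => evLinear_injective ?_⟩
  · have hz := congrFun (hB r r.lt_succ_self) z
    rw [hzero, map_zero] at hz
    exact (mul_eq_zero.mp hz.symm).resolve_right (zpow_ne_zero _ z.ne_zero)
  · rw [evLinear_map_T_mul_T_neg h, map_sum]
    refine Finset.sum_congr rfl fun k hk => ?_
    rw [map_smul, hB k (Finset.mem_range.mp hk)]

lemma coeff_sum_C_mul_descPochhammer (b : ℕ → ℂ) (r : ℕ) :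
    (∑ k ∈ Finset.range (r + 1), C (b k) * descPochhammer ℂ k).coeff r = b r := by
  have hlead := (monic_descPochhammer ℂ r).coeff_natDegree
  rw [descPochhammer_natDegree] at hlead
  rw [finsetSum_coeff, Finset.sum_range_succ, Finset.sum_eq_zero, zero_add, coeff_C_mul, hlead,
    mul_one]
  intro k hk
  rw [coeff_C_mul, coeff_eq_zero_of_natDegree_lt, mul_zero]
  exact (descPochhammer_natDegree ℂ k).trans_lt (Finset.mem_range.mp hk)

lemma IsDiffOp.exists_symbol (hD : IsDiffOp r D) :
    ∃ P : ℤ → ℂ[X], (∃ m, (P m).coeff r ≠ 0) ∧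
      ∀ j m : ℤ, (D (T j)).coeff (j + m) = (P m).eval (j : ℂ) := by
  obtain ⟨B, hBr, hB⟩ := hD.exists_map_T
  obtain ⟨m₀, hm₀⟩ : ∃ m, (B r).coeff m ≠ 0 := by
    by_contra! hzero
    exact hBr (LaurentPolynomial.ext hzero)
  refine ⟨fun m => ∑ k ∈ Finset.range (r + 1), C ((B k).coeff m) * descPochhammer ℂ k,
    ⟨m₀, by rwa [coeff_sum_C_mul_descPochhammer]⟩, fun j m => ?_⟩
  have hcoeff := congrArg (fun f : ℂ[T;T⁻¹] => f.coeff m) (hB j)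
  simp only [coeff_mul_T, AddMonoidAlgebra.coeff_sum, Finsupp.finsetSum_apply,
    AddMonoidAlgebra.coeff_smul, Finsupp.smul_apply, smul_eq_mul, sub_neg_eq_add] at hcoeff
  rw [add_comm, hcoeff, eval_finsetSum]
  refine Finset.sum_congr rfl fun k _ => ?_
  rw [eval_mul, eval_C, mul_comm]

end Symbol

section Euler

open LaurentPolynomial (T)

/-- The Euler operator `z d/dz`, which has all powers of `z` as eigenvectors. -/
def euler : ℂ[T;T⁻¹] →ₗ[ℂ] ℂ[T;T⁻¹] where
  toFun f := ddz f * T 1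
  map_add' f g := by
    ext i
    simp only [coeff_mul_T, coeff_ddz, AddMonoidAlgebra.coeff_add, Finsupp.add_apply]
    ring
  map_smul' c f := by rw [ddz_smul, smul_mul_assoc, RingHom.id_apply]

lemma isDiffOp_euler : IsDiffOp 1 euler := by
  refine ⟨fun k z => if k = 1 then z else 0, fun h => by simpa using congrFun h 1, fun f z => ?_⟩
  simp [euler, ev_T, mul_comm]

lemma euler_T (j : ℤ) : euler (T j) = (j : ℂ) • T j := by
  change ddz (T j) * T 1 = _
  rw [ddz_T, smul_mul_assoc, ← LaurentPolynomial.T_add, sub_add_cancel]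

end Euler

/-! ### The CMV basis as a sequence of ordinary polynomials -/

section Frame

open LaurentPolynomial (T)

lemma cmvExp_two_mul (k : ℕ) : cmvExp (2 * k) = k := by
  simp [cmvExp]

lemma cmvExp_two_mul_add_one (k : ℕ) : cmvExp (2 * k + 1) = -k - 1 := by
  rw [cmvExp, if_neg (by simp)]
  push_cast
  omega

lemma cmvExp_injective : Function.Injective cmvExp := by
  intro m n h
  obtain ⟨k, rfl | rfl⟩ := m.even_or_odd' <;> obtain ⟨l, rfl | rfl⟩ := n.even_or_odd' <;>
    simp only [cmvExp_two_mul, cmvExp_two_mul_add_one] at h <;> omega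

lemma cmvExp_surjective : Function.Surjective cmvExp := by
  intro i
  rcases i with k | k
  · exact ⟨2 * k, cmvExp_two_mul k⟩
  · exact ⟨2 * k + 1, by rw [cmvExp_two_mul_add_one, Int.negSucc_eq, neg_add']⟩

/-- The conjugate-linear involution `∑ cᵢ zⁱ ↦ ∑ conj cᵢ z⁻ⁱ`, which is complex conjugation of
functions on the unit circle. -/
def sharp : ℂ[T;T⁻¹] →+* ℂ[T;T⁻¹] :=
  (LaurentPolynomial.invert (R := ℂ)).toRingEquiv.toRingHom.comp
    (AddMonoidAlgebra.mapRingHom ℤ (starRingEnd ℂ))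

lemma coeff_sharp (f : ℂ[T;T⁻¹]) (i : ℤ) : (sharp f).coeff i = conj (f.coeff (-i)) := by
  simp [sharp]

/-- Szegő's reversal `f ↦ zⁿ conj f(1 / conj z)`, which reverses and conjugates the coefficients
`0, …, n`. -/
def reversal (n : ℕ) (f : ℂ[T;T⁻¹]) : ℂ[T;T⁻¹] :=
  sharp f * T n

lemma coeff_reversal (n : ℕ) (f : ℂ[T;T⁻¹]) (j : ℤ) :
    (reversal n f).coeff j = conj (f.coeff (n - j)) := by
  rw [reversal, coeff_mul_T, coeff_sharp, neg_sub]

lemma reversal_reversal (n : ℕ) (f : ℂ[T;T⁻¹]) : reversal n (reversal n f) = f := by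
  ext j
  rw [coeff_reversal, coeff_reversal, Complex.conj_conj, sub_sub_cancel]

lemma reversal_add (n : ℕ) (f g : ℂ[T;T⁻¹]) :
    reversal n (f + g) = reversal n f + reversal n g := by
  rw [reversal, map_add, add_mul, reversal, reversal]

lemma reversal_smul (n : ℕ) (c : ℂ) (f : ℂ[T;T⁻¹]) :
    reversal n (c • f) = conj c • reversal n f := by
  ext j
  simp [coeff_reversal]

/-- The change of coordinates under which the `n`-th Laurent polynomial of a CMV basis becomes a
polynomial of degree `n`, its leading power `z ^ cmvExp n` being sent to `z ^ n`. -/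
def cmvFrame : ℕ → ℂ[T;T⁻¹] → ℂ[T;T⁻¹]
  | 0, f => f
  | n + 1, f => reversal n (cmvFrame n f)

lemma coeff_cmvFrame_succ (n : ℕ) (f : ℂ[T;T⁻¹]) (j : ℤ) :
    (cmvFrame (n + 1) f).coeff j = conj ((cmvFrame n f).coeff (n - j)) :=
  coeff_reversal n _ j

lemma coeff_cmvFrame_two_mul (k : ℕ) (f : ℂ[T;T⁻¹]) (j : ℤ) :
    (cmvFrame (2 * k) f).coeff j = f.coeff (j - k) := by
  induction k generalizing j with
  | zero => simp [cmvFrame]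
  | succ k ih =>
    rw [mul_add_one, coeff_cmvFrame_succ, coeff_cmvFrame_succ, Complex.conj_conj, ih]
    congr 1
    push_cast
    ring

lemma coeff_cmvFrame_two_mul_add_one (k : ℕ) (f : ℂ[T;T⁻¹]) (j : ℤ) :
    (cmvFrame (2 * k + 1) f).coeff j = conj (f.coeff (k - j)) := by
  rw [coeff_cmvFrame_succ, coeff_cmvFrame_two_mul]
  congr 2
  push_cast
  ring

lemma cmvFrame_T_cmvExp (n : ℕ) : cmvFrame n (T (cmvExp n)) = T n := by
  ext j
  obtain ⟨k, rfl | rfl⟩ := n.even_or_odd'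
  · rw [coeff_cmvFrame_two_mul, cmvExp_two_mul, LaurentPolynomial.T_apply,
      LaurentPolynomial.T_apply]
    exact if_congr (by omega) rfl rfl
  · rw [coeff_cmvFrame_two_mul_add_one, cmvExp_two_mul_add_one, LaurentPolynomial.T_apply,
      LaurentPolynomial.T_apply, apply_ite conj, map_one, map_zero]
    exact if_congr (by omega) rfl rfl

lemma coeff_cmvFrame_self_eq_zero_iff (n : ℕ) (f : ℂ[T;T⁻¹]) :
    (cmvFrame n f).coeff n = 0 ↔ f.coeff (cmvExp n) = 0 := by
  obtain ⟨k, rfl | rfl⟩ := n.even_or_odd'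
  · rw [coeff_cmvFrame_two_mul, cmvExp_two_mul]
    push_cast
    ring_nf
  · rw [coeff_cmvFrame_two_mul_add_one, cmvExp_two_mul_add_one,
      _root_.map_eq_zero]
    push_cast
    ring_nf

lemma cmvFrame_bijective (n : ℕ) : Function.Bijective (cmvFrame n) := by
  induction n with
  | zero => exact Function.bijective_id
  | succ n ih => exact (Function.Involutive.bijective (reversal_reversal n)).comp ih

lemma cmvFrame_add (n : ℕ) (f g : ℂ[T;T⁻¹]) :
    cmvFrame n (f + g) = cmvFrame n f + cmvFrame n g := by
  induction n with
  | zero => rfl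
  | succ n ih => rw [cmvFrame, ih, reversal_add, cmvFrame, cmvFrame]

lemma cmvFrame_smul (n : ℕ) (c : ℂ) (f : ℂ[T;T⁻¹]) :
    cmvFrame n (c • f) = ((starRingEnd ℂ)^[n] c) • cmvFrame n f := by
  induction n with
  | zero => rfl
  | succ n ih => rw [cmvFrame, ih, reversal_smul, cmvFrame, Function.iterate_succ_apply']

/-- The Laurent polynomials `∑ cⱼ zʲ` with `a ≤ j < b`. -/
def coeffIco (a b : ℤ) : Submodule ℂ ℂ[T;T⁻¹] where
  carrier := {f | ∀ j ∉ Set.Ico a b, f.coeff j = 0}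
  add_mem' hf hg j hj := by simp [hf j hj, hg j hj]
  zero_mem' _ _ := by simp
  smul_mem' c f hf j hj := by simp [hf j hj]

lemma mem_coeffIco_iff {a b : ℤ} {f : ℂ[T;T⁻¹]} :
    f ∈ coeffIco a b ↔ ∀ j ∉ Set.Ico a b, f.coeff j = 0 := Iff.rfl

lemma reversal_mem_coeffIco_iff {n : ℕ} {a b : ℤ} {f : ℂ[T;T⁻¹]} :
    reversal n f ∈ coeffIco a b ↔ f ∈ coeffIco (n + 1 - b) (n + 1 - a) := by
  refine ⟨fun h j hj => ?_, fun h j hj => ?_⟩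
  · rw [← reversal_reversal n f, coeff_reversal, h, map_zero]
    rw [Set.mem_Ico] at hj ⊢
    omega
  · rw [coeff_reversal, h, map_zero]
    rw [Set.mem_Ico] at hj ⊢
    omega

lemma mul_T_mem_coeffIco_iff {n a b : ℤ} {f : ℂ[T;T⁻¹]} :
    f * T n ∈ coeffIco a b ↔ f ∈ coeffIco (a - n) (b - n) := by
  simp only [mem_coeffIco_iff, coeff_mul_T, Set.mem_Ico]
  refine ⟨fun h j hj => ?_, fun h j hj => h _ (by omega)⟩
  simpa using h (j + n) (by omega)

/-- The span of the first `n` of the powers `1, z⁻¹, z, z⁻², z², …`, described in the coordinates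
`cmvFrame n`. -/
def flag (n : ℕ) : Submodule ℂ ℂ[T;T⁻¹] where
  carrier := {f | cmvFrame n f ∈ coeffIco 0 n}
  add_mem' hf hg := by
    rw [Set.mem_ofPred_eq, cmvFrame_add]
    exact add_mem hf hg
  zero_mem' := by
    rw [Set.mem_ofPred_eq, ← zero_smul ℂ (0 : ℂ[T;T⁻¹]), cmvFrame_smul, iterate_map_zero, zero_smul]
    exact zero_mem _
  smul_mem' c f hf := by
    rw [Set.mem_ofPred_eq, cmvFrame_smul]
    exact Submodule.smul_mem _ _ hf

lemma mem_flag_iff {n : ℕ} {f : ℂ[T;T⁻¹]} : f ∈ flag n ↔ cmvFrame n f ∈ coeffIco 0 n := Iff.rfl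

lemma mem_flag_succ_iff {n : ℕ} {f : ℂ[T;T⁻¹]} :
    f ∈ flag (n + 1) ↔ cmvFrame n f ∈ coeffIco 0 (n + 1) := by
  rw [mem_flag_iff, cmvFrame, reversal_mem_coeffIco_iff]
  push_cast
  rw [sub_self, sub_zero]

lemma eq_zero_of_mem_flag_zero {f : ℂ[T;T⁻¹]} (hf : f ∈ flag 0) : f = 0 :=
  LaurentPolynomial.ext fun j => hf j (by simp)

lemma flag_mono : Monotone flag :=
  monotone_nat_of_le_succ fun _ _ hf => mem_flag_succ_iff.mpr fun j hj =>
    hf j fun hmem => hj ⟨hmem.1, hmem.2.trans (lt_add_one _)⟩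

lemma mem_flag_of_coeff_eq_zero {n : ℕ} {f : ℂ[T;T⁻¹]} (hf : f ∈ flag (n + 1))
    (hlead : f.coeff (cmvExp n) = 0) : f ∈ flag n := by
  intro j hj
  rcases eq_or_ne j n with rfl | hjn
  · exact (coeff_cmvFrame_self_eq_zero_iff n f).mpr hlead
  · refine mem_flag_succ_iff.mp hf j ?_
    rw [Set.mem_Ico] at hj ⊢
    omega

lemma coeff_cmvExp_eq_zero_of_mem_flag {m n : ℕ} (hmn : m ≤ n) {f : ℂ[T;T⁻¹]} (hf : f ∈ flag m) :
    f.coeff (cmvExp n) = 0 :=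
  (coeff_cmvFrame_self_eq_zero_iff n f).mp (flag_mono hmn hf n (by simp))

lemma T_cmvExp_mem_flag (n : ℕ) : (T (cmvExp n) : ℂ[T;T⁻¹]) ∈ flag (n + 1) := by
  rw [mem_flag_succ_iff, cmvFrame_T_cmvExp]
  intro j hj
  rw [LaurentPolynomial.T_apply, if_neg]
  rintro rfl
  exact hj (by simp)

lemma span_T_cmvExp_le_flag (n : ℕ) :
    Submodule.span ℂ ((fun k => (T (cmvExp k) : ℂ[T;T⁻¹])) '' Set.Iic n) ≤ flag (n + 1) := by
  rw [Submodule.span_le]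
  rintro _ ⟨k, hk, rfl⟩
  exact flag_mono (Nat.succ_le_succ hk) (T_cmvExp_mem_flag k)

lemma eventually_mem_flag (f : ℂ[T;T⁻¹]) : ∀ᶠ n in atTop, f ∈ flag n := by
  induction f using LaurentPolynomial.induction_on' with
  | add f g hf hg => exact (hf.and hg).mono fun n h => add_mem h.1 h.2
  | C_mul_T i c =>
    obtain ⟨k, rfl⟩ := cmvExp_surjective i
    filter_upwards [eventually_ge_atTop (k + 1)] with n hn
    rw [← LaurentPolynomial.smul_eq_C_mul]
    exact Submodule.smul_mem _ _ (flag_mono hn (T_cmvExp_mem_flag k))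

end Frame

/-! ### Laurent polynomials in `L²(μ)` -/

section L2

open LaurentPolynomial (T)
open scoped InnerProductSpace

lemma ev_toUnits_T (z : Circle) (n : ℤ) : ev z.toUnits (T n) = (z : ℂ) ^ n :=
  ev_T z.toUnits n

lemma ev_toUnits_sharp (z : Circle) (f : ℂ[T;T⁻¹]) :
    ev z.toUnits (sharp f) = conj (ev z.toUnits f) := by
  induction f using LaurentPolynomial.induction_on' with
  | add f g hf hg => simp only [map_add, hf, hg]
  | C_mul_T n c =>
    have h_sharp : sharp (c • T n) = conj c • T (-n) := by
      ext i
      simp [coeff_sharp, LaurentPolynomial.T_apply, neg_eq_iff_eq_neg, apply_ite conj]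
    rw [← LaurentPolynomial.smul_eq_C_mul, h_sharp, ev_smul, ev_smul, map_mul, ev_toUnits_T,
      ev_toUnits_T, map_zpow₀, ← Circle.coe_inv_eq_conj, Circle.coe_inv, inv_zpow']

lemma continuous_ev (f : ℂ[T;T⁻¹]) : Continuous fun z : Circle => ev z.toUnits f := by
  induction f using LaurentPolynomial.induction_on' with
  | add f g hf hg =>
    simp only [map_add]
    exact hf.add hg
  | C_mul_T n c =>
    simp only [← LaurentPolynomial.smul_eq_C_mul, ev_smul, ev_toUnits_T]
    exact continuous_const.mul
      (Continuous.zpow₀ (by fun_prop) n fun z => Or.inl z.coe_ne_zero)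

variable (μ : Measure Circle) [IsFiniteMeasure μ]

/-- The restriction of a Laurent polynomial to the unit circle, as an element of `L²(μ)`. -/
def toL2 : ℂ[T;T⁻¹] →ₗ[ℂ] Lp ℂ 2 μ :=
  (ContinuousMap.toLp (E := ℂ) 2 μ ℂ).toLinearMap ∘ₗ
    { toFun := fun f => ⟨fun z => ev z.toUnits f, continuous_ev f⟩
      map_add' := fun f g => ContinuousMap.ext fun z => map_add (ev z.toUnits) f g
      map_smul' := fun c f => ContinuousMap.ext fun z => ev_smul z.toUnits c f }

lemma inner_toL2 (f g : ℂ[T;T⁻¹]) :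
    ⟪toL2 μ f, toL2 μ g⟫_ℂ = ∫ z : Circle, ev z.toUnits g * conj (ev z.toUnits f) ∂μ :=
  ContinuousMap.inner_toLp μ _ _

lemma inner_toL2_mul_T (f g : ℂ[T;T⁻¹]) (n : ℤ) :
    ⟪toL2 μ (f * T n), toL2 μ (g * T n)⟫_ℂ = ⟪toL2 μ f, toL2 μ g⟫_ℂ := by
  rw [inner_toL2, inner_toL2]
  congr 1 with z
  have h_unimodular : (z : ℂ) ^ n * conj ((z : ℂ) ^ n) = 1 := by
    rw [Complex.mul_conj', norm_zpow, Circle.norm_coe, one_zpow, Complex.ofReal_one, one_pow]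
  rw [map_mul, map_mul, map_mul, ev_toUnits_T, mul_mul_mul_comm, h_unimodular, mul_one]

lemma inner_toL2_sharp (f g : ℂ[T;T⁻¹]) :
    ⟪toL2 μ (sharp f), toL2 μ (sharp g)⟫_ℂ = ⟪toL2 μ g, toL2 μ f⟫_ℂ := by
  rw [inner_toL2, inner_toL2]
  congr 1 with z
  rw [ev_toUnits_sharp, ev_toUnits_sharp, Complex.conj_conj, mul_comm]

lemma inner_toL2_reversal (n : ℕ) (f g : ℂ[T;T⁻¹]) :
    ⟪toL2 μ (reversal n f), toL2 μ (reversal n g)⟫_ℂ = ⟪toL2 μ g, toL2 μ f⟫_ℂ := by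
  rw [reversal, reversal, inner_toL2_mul_T, inner_toL2_sharp]

lemma inner_toL2_cmvFrame_eq_zero_iff (n : ℕ) (f g : ℂ[T;T⁻¹]) :
    ⟪toL2 μ (cmvFrame n f), toL2 μ (cmvFrame n g)⟫_ℂ = 0 ↔ ⟪toL2 μ f, toL2 μ g⟫_ℂ = 0 := by
  induction n with
  | zero => rfl
  | succ n ih => rw [cmvFrame, cmvFrame, inner_toL2_reversal, inner_eq_zero_symm, ih]

lemma norm_toL2_mul_T (f : ℂ[T;T⁻¹]) (n : ℤ) : ‖toL2 μ (f * T n)‖ = ‖toL2 μ f‖ := by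
  rw [norm_eq_sqrt_re_inner (𝕜 := ℂ), inner_toL2_mul_T, ← norm_eq_sqrt_re_inner]

lemma norm_toL2_reversal (n : ℕ) (f : ℂ[T;T⁻¹]) : ‖toL2 μ (reversal n f)‖ = ‖toL2 μ f‖ := by
  rw [norm_eq_sqrt_re_inner (𝕜 := ℂ), inner_toL2_reversal, ← norm_eq_sqrt_re_inner]

end L2

/-! ### Szegő polynomials -/

section Szego

open LaurentPolynomial (T)
open scoped InnerProductSpace

variable {μ : Measure Circle} {x : ℕ → ℂ[T;T⁻¹]}

namespace IsOLP

lemma mem_flag (hx : IsOLP μ x) (n : ℕ) : x n ∈ flag (n + 1) :=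
  span_T_cmvExp_le_flag n (hx.mem_span n)

variable [IsFiniteMeasure μ]

lemma orthonormal_toL2 (hx : IsOLP μ x) : Orthonormal ℂ (toL2 μ ∘ x) :=
  orthonormal_iff_ite.mpr fun m n =>
    (inner_toL2 μ (x m) (x n)).trans ((hx.orthonormal n m).trans (if_congr eq_comm rfl rfl))

lemma linearIndependent (hx : IsOLP μ x) : LinearIndependent ℂ x :=
  .of_comp (toL2 μ) hx.orthonormal_toL2.linearIndependent

lemma coeff_cmvExp_ne_zero_of_flag_le (hx : IsOLP μ x) {n : ℕ}
    (hle : flag n ≤ Submodule.span ℂ (x '' Set.Iio n)) : (x n).coeff (cmvExp n) ≠ 0 := fun h =>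
  hx.linearIndependent.notMem_span_image (s := Set.Iio n) (lt_irrefl n)
    (hle (mem_flag_of_coeff_eq_zero (hx.mem_flag n) h))

lemma flag_le_span (hx : IsOLP μ x) (n : ℕ) : flag n ≤ Submodule.span ℂ (x '' Set.Iio n) := by
  induction n with
  | zero => exact fun f hf => eq_zero_of_mem_flag_zero hf ▸ zero_mem _
  | succ n ih =>
    intro f hf
    have hlead := hx.coeff_cmvExp_ne_zero_of_flag_le ih
    set c := f.coeff (cmvExp n) / (x n).coeff (cmvExp n)
    have h_sub : f - c • x n ∈ flag n := by
      refine mem_flag_of_coeff_eq_zero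
        (sub_mem hf (Submodule.smul_mem _ _ (hx.mem_flag n))) ?_
      simp [c, hlead]
    have h_mono : x '' Set.Iio n ⊆ x '' Set.Iio (n + 1) :=
      Set.image_mono (Set.Iio_subset_Iio n.le_succ)
    rw [← sub_add_cancel f (c • x n)]
    exact add_mem (Submodule.span_mono h_mono (ih h_sub)) <|
      Submodule.smul_mem _ _ (Submodule.subset_span ⟨n, n.lt_succ_self, rfl⟩)

lemma coeff_cmvExp_ne_zero (hx : IsOLP μ x) (n : ℕ) : (x n).coeff (cmvExp n) ≠ 0 :=
  hx.coeff_cmvExp_ne_zero_of_flag_le (hx.flag_le_span n)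

lemma inner_eq_zero_of_mem_flag (hx : IsOLP μ x) {n : ℕ} {f : ℂ[T;T⁻¹]} (hf : f ∈ flag n) :
    ⟪toL2 μ (x n), toL2 μ f⟫_ℂ = 0 := by
  have h_span : Submodule.span ℂ (x '' Set.Iio n) ≤
      ((innerₛₗ ℂ (toL2 μ (x n))).comp (toL2 μ)).ker := by
    rw [Submodule.span_le]
    rintro _ ⟨k, hk, rfl⟩
    exact hx.orthonormal_toL2.2 (ne_of_gt hk)
  exact h_span (hx.flag_le_span n hf)

lemma toL2_injective (hx : IsOLP μ x) : Function.Injective (toL2 μ) := by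
  have h_span : Submodule.span ℂ (Set.range x) = ⊤ := by
    refine Submodule.eq_top_iff'.mpr fun f => ?_
    obtain ⟨n, hn⟩ := (eventually_mem_flag f).exists
    exact Submodule.span_mono (Set.image_subset_range _ _) (hx.flag_le_span n hn)
  have h_disjoint :=
    Submodule.range_ker_disjoint hx.orthonormal_toL2.linearIndependent
  rwa [h_span, top_disjoint, LinearMap.ker_eq_bot] at h_disjoint

end IsOLP

/-- The monic polynomial of degree `n` obtained from `x n` in the coordinates `cmvFrame n`: the
`n`-th monic orthogonal polynomial of `μ`. -/
def szegoPoly (x : ℕ → ℂ[T;T⁻¹]) (n : ℕ) : ℂ[T;T⁻¹] :=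
  ((cmvFrame n (x n)).coeff n)⁻¹ • cmvFrame n (x n)

lemma coeffIco_mono {a b c d : ℤ} (hca : c ≤ a) (hbd : b ≤ d) : coeffIco a b ≤ coeffIco c d :=
  fun _ hf j hj => hf j fun hmem => hj (Set.Ico_subset_Ico hca hbd hmem)

/-- Pythagoras' theorem gives `‖c‖² = 1 - (‖v + c • w‖ / ‖w‖)²`. -/
lemma norm_lt_one_of_inner_eq_zero {𝕜 E : Type*} [RCLike 𝕜] [NormedAddCommGroup E]
    [InnerProductSpace 𝕜 E] {v w : E} {c : 𝕜} (horth : inner 𝕜 (v + c • w) w = 0)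
    (hnorm : ‖v‖ = ‖w‖) (hne : v + c • w ≠ 0) : ‖c‖ < 1 := by
  have h_pythagoras : ‖v‖ * ‖v‖ =
      ‖v + c • w‖ * ‖v + c • w‖ + ‖c‖ * ‖w‖ * (‖c‖ * ‖w‖) := by
    have h := norm_add_sq_eq_norm_sq_add_norm_sq_of_inner_eq_zero (𝕜 := 𝕜) (v + c • w) (-(c • w))
      (by rw [inner_neg_right, inner_smul_right, horth, mul_zero, neg_zero])
    rwa [add_neg_cancel_right, norm_neg, norm_smul] at h
  have h_pos : 0 < ‖v + c • w‖ := norm_pos_iff.mpr hne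
  have h_lt : ‖c‖ * ‖w‖ < 1 * ‖w‖ := by
    rw [one_mul]
    refine lt_of_mul_self_lt_mul_self₀ (norm_nonneg w) ?_
    rw [← hnorm] at h_pythagoras ⊢
    linarith [mul_pos h_pos h_pos]
  exact lt_of_mul_lt_mul_right h_lt (norm_nonneg w)

namespace IsOLP

lemma szegoPoly_mem_coeffIco (hx : IsOLP μ x) (n : ℕ) : szegoPoly x n ∈ coeffIco 0 (n + 1) :=
  Submodule.smul_mem _ _ (mem_flag_succ_iff.mp (hx.mem_flag n))

variable [IsFiniteMeasure μ]

lemma coeff_cmvFrame_self_ne_zero (hx : IsOLP μ x) (n : ℕ) : (cmvFrame n (x n)).coeff n ≠ 0 :=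
  (coeff_cmvFrame_self_eq_zero_iff n (x n)).not.mpr (hx.coeff_cmvExp_ne_zero n)

lemma coeff_szegoPoly_self (hx : IsOLP μ x) (n : ℕ) : (szegoPoly x n).coeff n = 1 := by
  simp [szegoPoly, hx.coeff_cmvFrame_self_ne_zero n]

lemma inner_szegoPoly_eq_zero (hx : IsOLP μ x) {n : ℕ} {f : ℂ[T;T⁻¹]} (hf : f ∈ coeffIco 0 n) :
    ⟪toL2 μ (szegoPoly x n), toL2 μ f⟫_ℂ = 0 := by
  obtain ⟨g, rfl⟩ := (cmvFrame_bijective n).surjective f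
  rw [szegoPoly, map_smul, inner_smul_left, (inner_toL2_cmvFrame_eq_zero_iff μ n _ _).mpr
    (hx.inner_eq_zero_of_mem_flag hf), mul_zero]

lemma inner_szegoPoly_mul_T_eq_zero (hx : IsOLP μ x) {n : ℕ} {f : ℂ[T;T⁻¹]}
    (hf : f ∈ coeffIco 1 (n + 1)) : ⟪toL2 μ (szegoPoly x n * T 1), toL2 μ f⟫_ℂ = 0 := by
  have h_shift : f * T (-1) ∈ coeffIco 0 n := by
    rw [mul_T_mem_coeffIco_iff]
    simpa using hf
  have hf_eq : f * T (-1) * T 1 = f := by simp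
  rw [← hf_eq, inner_toL2_mul_T, hx.inner_szegoPoly_eq_zero h_shift]

lemma inner_reversal_szegoPoly_eq_zero (hx : IsOLP μ x) {n : ℕ} {f : ℂ[T;T⁻¹]}
    (hf : f ∈ coeffIco 1 (n + 1)) : ⟪toL2 μ (reversal n (szegoPoly x n)), toL2 μ f⟫_ℂ = 0 := by
  have h_reversal : reversal n f ∈ coeffIco 0 n := by
    rw [reversal_mem_coeffIco_iff]
    simpa using hf
  rw [← reversal_reversal n f, inner_toL2_reversal, inner_eq_zero_symm,
    hx.inner_szegoPoly_eq_zero h_reversal]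

lemma szegoPoly_succ (hx : IsOLP μ x) (n : ℕ) :
    szegoPoly x (n + 1) =
      szegoPoly x n * T 1 + (szegoPoly x (n + 1)).coeff 0 • reversal n (szegoPoly x n) := by
  set Φ := szegoPoly x n
  set γ := (szegoPoly x (n + 1)).coeff 0 with hγ
  have hΦ : Φ.coeff n = 1 := hx.coeff_szegoPoly_self n
  have hΦ' : (szegoPoly x (n + 1)).coeff (n + 1) = 1 := hx.coeff_szegoPoly_self (n + 1)
  have hΦ_neg : Φ.coeff (-1) = 0 := hx.szegoPoly_mem_coeffIco n _ (by simp)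
  set R := szegoPoly x (n + 1) - (Φ * T 1 + γ • reversal n Φ) with hR
  have h_coeff (j : ℤ) : R.coeff j =
      (szegoPoly x (n + 1)).coeff j - (Φ.coeff (j - 1) + γ * conj (Φ.coeff (n - j))) := by
    simp [hR, coeff_mul_T, coeff_reversal]
  have hR_mem : R ∈ coeffIco 1 (n + 1) := by
    intro j hj
    rw [h_coeff]
    rcases eq_or_ne j 0 with rfl | hj_zero
    · simp [hΦ, hΦ_neg, ← hγ]
    rcases eq_or_ne j (n + 1) with rfl | hj_top
    · simp [hΦ, hΦ', hΦ_neg]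
    rw [Set.mem_Ico] at hj
    rw [hx.szegoPoly_mem_coeffIco (n + 1) j (by rw [Set.mem_Ico]; push_cast; omega),
      hx.szegoPoly_mem_coeffIco n (j - 1) (by rw [Set.mem_Ico]; omega),
      hx.szegoPoly_mem_coeffIco n (n - j) (by rw [Set.mem_Ico]; omega)]
    simp
  have h_orth {g : ℂ[T;T⁻¹]} (hg : g ∈ coeffIco 1 (n + 1)) : ⟪toL2 μ R, toL2 μ g⟫_ℂ = 0 := by
    rw [hR, map_sub, map_add, map_smul, inner_sub_left, inner_add_left, inner_smul_left,
      hx.inner_szegoPoly_eq_zero (coeffIco_mono zero_le_one (by simp) hg),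
      hx.inner_szegoPoly_mul_T_eq_zero hg, hx.inner_reversal_szegoPoly_eq_zero hg]
    simp
  rw [← sub_eq_zero]
  exact (map_eq_zero_iff _ hx.toL2_injective).mp (inner_self_eq_zero.mp (h_orth hR_mem))

lemma norm_coeff_zero_szegoPoly_lt (hx : IsOLP μ x) (n : ℕ) :
    ‖(szegoPoly x (n + 1)).coeff 0‖ < 1 := by
  have h_succ : toL2 μ (szegoPoly x (n + 1)) = toL2 μ (szegoPoly x n * T 1) +
      (szegoPoly x (n + 1)).coeff 0 • toL2 μ (reversal n (szegoPoly x n)) := by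
    rw [← map_smul, ← map_add, ← hx.szegoPoly_succ]
  have h_reversal : reversal n (szegoPoly x n) ∈ coeffIco 0 (n + 1 : ℕ) := by
    rw [reversal_mem_coeffIco_iff]
    simpa using hx.szegoPoly_mem_coeffIco n
  have h_ne : szegoPoly x (n + 1) ≠ 0 := fun h => by
    simpa [h] using hx.coeff_szegoPoly_self (n + 1)
  refine norm_lt_one_of_inner_eq_zero (𝕜 := ℂ) (v := toL2 μ (szegoPoly x n * T 1))
    (w := toL2 μ (reversal n (szegoPoly x n))) ?_ ?_ ?_
  · rw [← h_succ, hx.inner_szegoPoly_eq_zero h_reversal]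
  · rw [norm_toL2_mul_T, norm_toL2_reversal]
  · rw [← h_succ]
    exact (map_ne_zero_iff _ hx.toL2_injective).mpr h_ne

lemma isSzegoArray (hx : IsOLP μ x) : IsSzegoArray fun n j => (szegoPoly x n).coeff j where
  diag := hx.coeff_szegoPoly_self
  of_neg n j hj := hx.szegoPoly_mem_coeffIco n j (by rw [Set.mem_Ico]; omega)
  step n j := by
    conv_lhs => rw [hx.szegoPoly_succ n]
    simp [coeff_mul_T, coeff_reversal]
  norm_lt := hx.norm_coeff_zero_szegoPoly_lt

end IsOLP

end Szego

/-! ### Bispectral sequences -/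

section Bispectral

open LaurentPolynomial (T)

variable {μ : Measure Circle} {x : ℕ → ℂ[T;T⁻¹]} {D : ℂ[T;T⁻¹] →ₗ[ℂ] ℂ[T;T⁻¹]} {n₀ : ℕ}

lemma span_triple_le_flag (hx : IsOLP μ x) (n : ℕ) :
    Submodule.span ℂ {x (n - 1), x n, x (n + 1)} ≤ flag (n + 2) := by
  rw [Submodule.span_le]
  rintro _ (rfl | rfl | rfl) <;> exact flag_mono (by omega) (hx.mem_flag _)

lemma IsOLP.eventually_map_mem_flag [IsFiniteMeasure μ] (hx : IsOLP μ x)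
    (hD : ∀ n ≥ n₀, D (x n) ∈ Submodule.span ℂ {x (n - 1), x n, x (n + 1)}) :
    ∀ᶠ n in atTop, flag n ≤ (flag (n + 1)).comap D := by
  filter_upwards [(eventually_all_finite (Set.finite_Iio n₀)).mpr fun k _ =>
    eventually_mem_flag (D (x k))] with n hn
  refine (hx.flag_le_span n).trans (Submodule.span_le.mpr ?_)
  rintro _ ⟨k, hk, rfl⟩
  rcases lt_or_ge k n₀ with hk₀ | hk₀
  · exact flag_mono n.le_succ (hn k hk₀)
  · exact flag_mono (Nat.succ_le_succ hk) (span_triple_le_flag hx k (hD k hk₀))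

lemma exists_cmvExp_add_eq (m : ℤ) :
    ∃ ε : ℕ, ∀ k : ℕ, cmvExp (2 * k + ε) + m = cmvExp (2 * k + ε + 2 * m.natAbs) := by
  rcases le_total 0 m with hm | hm
  · refine ⟨0, fun k => ?_⟩
    rw [add_zero, ← mul_add, cmvExp_two_mul, cmvExp_two_mul]
    omega
  · refine ⟨1, fun k => ?_⟩
    rw [add_right_comm, ← mul_add, cmvExp_two_mul_add_one, cmvExp_two_mul_add_one]
    omega

/-- A nonzero shift by `m` moves infinitely many of the powers of `z` by `2 * |m| ≥ 2` steps up the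
flag. -/
lemma symbol_eq_zero {P : ℤ → ℂ[X]} (hP : ∀ j m : ℤ, (D (T j)).coeff (j + m) = (P m).eval (j : ℂ))
    (hflag : ∀ᶠ n in atTop, flag n ≤ (flag (n + 1)).comap D) {m : ℤ} (hm : m ≠ 0) : P m = 0 := by
  obtain ⟨N, hN⟩ := eventually_atTop.mp hflag
  obtain ⟨ε, hε⟩ := exists_cmvExp_add_eq m
  have hroot (k : ℕ) : (P m).IsRoot (cmvExp (2 * (k + N) + ε)) := by
    have hmem := Submodule.mem_comap.mp
      (hN (2 * (k + N) + ε + 1) (by omega) (T_cmvExp_mem_flag (2 * (k + N) + ε)))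
    rw [IsRoot, ← hP, hε]
    exact coeff_cmvExp_eq_zero_of_mem_flag (by omega) hmem
  have hinj : Function.Injective fun k : ℕ => (cmvExp (2 * (k + N) + ε) : ℂ) := fun k l h => by
    have hkl := cmvExp_injective (Int.cast_injective h)
    omega
  refine Polynomial.eq_zero_of_infinite_isRoot (P m) ?_
  exact Set.infinite_of_injective_forall_mem (s := {z | (P m).IsRoot z}) hinj hroot

lemma IsDiffOp.exists_diagonal_symbol {r : ℕ} (hr : 1 ≤ r) (hDr : IsDiffOp r D)
    (hflag : ∀ᶠ n in atTop, flag n ≤ (flag (n + 1)).comap D) :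
    ∃ p : ℂ[X], 0 < p.natDegree ∧ ∀ f i, (D f).coeff i = p.eval (i : ℂ) * f.coeff i := by
  obtain ⟨P, ⟨m, hm⟩, hP⟩ := hDr.exists_symbol
  have hm_zero : m = 0 := by
    by_contra h
    exact hm (by rw [symbol_eq_zero hP hflag h, coeff_zero])
  refine ⟨P 0, hr.trans (le_natDegree_of_ne_zero (hm_zero ▸ hm)), fun f i => ?_⟩
  induction f using LaurentPolynomial.induction_on' with
  | add f g hf hg =>
    simp only [map_add, AddMonoidAlgebra.coeff_add, Finsupp.add_apply, hf, hg, mul_add]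
  | C_mul_T j c =>
    have h_T : (D (T j)).coeff i = (P 0).eval (i : ℂ) * (T j : ℂ[T;T⁻¹]).coeff i := by
      rw [← add_sub_cancel j i, hP, LaurentPolynomial.T_apply, add_sub_cancel]
      split_ifs with hij
      · rw [hij, sub_self, mul_one]
      · rw [symbol_eq_zero hP hflag (sub_ne_zero.mpr (Ne.symm hij)), eval_zero, mul_zero]
    rw [← LaurentPolynomial.smul_eq_C_mul, map_smul]
    simp only [AddMonoidAlgebra.coeff_smul, Finsupp.smul_apply, smul_eq_mul, h_T]
    ring

section Diagonal

variable {p : ℂ[X]} (hp : ∀ f i, (D f).coeff i = p.eval (i : ℂ) * f.coeff i)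

include hp

lemma coeff_cmvFrame_map (n : ℕ) (f : ℂ[T;T⁻¹]) (j : ℤ) :
    (cmvFrame n (D f)).coeff j = eigenvalue p n j * (cmvFrame n f).coeff j := by
  induction n generalizing j with
  | zero => simp [cmvFrame, eigenvalue, hp]
  | succ n ih =>
    rw [coeff_cmvFrame_succ, ih, map_mul, conj_eigenvalue_sub, coeff_cmvFrame_succ]

variable [IsFiniteMeasure μ]

lemma exists_two_term_relation (hx : IsOLP μ x) {n : ℕ}
    (hD : D (x (n + 1)) ∈ Submodule.span ℂ {x n, x (n + 1), x (n + 2)}) :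
    ∃ κ : ℂ, ∀ j : ℤ, (eigenvalue p (n + 1) j - eigenvalue p (n + 1) (n + 1)) *
      (cmvFrame (n + 1) (x (n + 1))).coeff j = κ * conj ((cmvFrame n (x n)).coeff (n - j)) := by
  obtain ⟨a, b, c, h⟩ := Submodule.mem_span_triple.mp hD
  have hvanish (k : ℕ) {j : ℤ} (hj : j ∉ Set.Ico 0 ((k : ℤ) + 1)) :
      (cmvFrame k (x k)).coeff j = 0 := mem_flag_succ_iff.mp (hx.mem_flag k) j hj
  set a' := (starRingEnd ℂ)^[n + 1] a
  set b' := (starRingEnd ℂ)^[n + 1] b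
  set c' := (starRingEnd ℂ)^[n + 1] c
  have hrel (j : ℤ) : eigenvalue p (n + 1) j * (cmvFrame (n + 1) (x (n + 1))).coeff j =
      a' * conj ((cmvFrame n (x n)).coeff (n - j)) + b' * (cmvFrame (n + 1) (x (n + 1))).coeff j +
        c' * conj ((cmvFrame (n + 2) (x (n + 2))).coeff (n + 1 - j)) := by
    rw [← coeff_cmvFrame_map hp, ← h, cmvFrame_add, cmvFrame_add, cmvFrame_smul, cmvFrame_smul,
      cmvFrame_smul, coeff_cmvFrame_succ (n + 1) (x (n + 2))]
    simp [a', b', c', coeff_cmvFrame_succ n (x n)]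
  have hc : c' = 0 := by
    have hbot := hrel (-1)
    rw [hvanish (n + 1) (by simp), hvanish n (by simp)] at hbot
    have hlead := hx.coeff_cmvFrame_self_ne_zero (n + 2)
    rw [show ((n + 2 : ℕ) : ℤ) = n + 1 + 1 by push_cast; ring] at hlead
    simpa [hlead] using hbot
  have hb : b' = eigenvalue p (n + 1) (n + 1) := by
    have htop := hrel (n + 1)
    have hlead := hx.coeff_cmvFrame_self_ne_zero (n + 1)
    rw [hvanish n (by simp), hc] at htop
    push_cast at hlead
    simpa [hlead] using htop.symm
  refine ⟨a', fun j => ?_⟩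
  rw [sub_mul, hrel, hc, hb]
  ring

lemma isBispectralArray_szegoPoly (hx : IsOLP μ x)
    (hD : ∀ n ≥ n₀, D (x n) ∈ Submodule.span ℂ {x (n - 1), x n, x (n + 1)}) :
    IsBispectralArray p n₀ fun n j => (szegoPoly x n).coeff j := by
  intro n hn
  have hD_succ := hD (n + 1) (hn.trans n.le_succ)
  rw [add_tsub_cancel_right] at hD_succ
  obtain ⟨κ, hκ⟩ := exists_two_term_relation hp hx hD_succ
  have hlead := (_root_.map_ne_zero conj).mpr (hx.coeff_cmvFrame_self_ne_zero n)
  refine ⟨((cmvFrame (n + 1) (x (n + 1))).coeff (n + 1 : ℕ))⁻¹ * κ *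
    conj ((cmvFrame n (x n)).coeff n), fun j => ?_⟩
  simp only [szegoPoly, AddMonoidAlgebra.coeff_smul, Finsupp.smul_apply, smul_eq_mul, map_mul,
    map_inv₀]
  rw [mul_left_comm, hκ]
  field_simp

end Diagonal

lemma IsOLP.eq_smul_T_of_szegoPoly_eq [IsFiniteMeasure μ] (hx : IsOLP μ x) {n : ℕ}
    (h : szegoPoly x n = T n) : ∃ c : ℂ, x n = c • T (cmvExp n) := by
  obtain ⟨c, hc⟩ : ∃ c, (starRingEnd ℂ)^[n] c = (cmvFrame n (x n)).coeff n :=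
    (star_involutive.bijective.iterate n).surjective _
  refine ⟨c, (cmvFrame_bijective n).injective ?_⟩
  rw [cmvFrame_smul, cmvFrame_T_cmvExp, hc, ← h, szegoPoly, smul_smul,
    mul_inv_cancel₀ (hx.coeff_cmvFrame_self_ne_zero n), one_smul]

theorem IsOLP.exists_eq_smul_T_of_bispectral [IsFiniteMeasure μ] (hx : IsOLP μ x) {r : ℕ}
    (hr : 1 ≤ r) (hDr : IsDiffOp r D)
    (hD : ∀ n ≥ n₀, D (x n) ∈ Submodule.span ℂ {x (n - 1), x n, x (n + 1)}) (n : ℕ) :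
    ∃ c : ℂ, x n = c • T (cmvExp n) := by
  obtain ⟨p, hp_deg, hp⟩ := hDr.exists_diagonal_symbol hr (hx.eventually_map_mem_flag hD)
  have hcoeff := (isBispectralArray_szegoPoly hp hx hD).eq_ite hx.isSzegoArray hp_deg n
  refine hx.eq_smul_T_of_szegoPoly_eq (LaurentPolynomial.ext fun j => ?_)
  rw [hcoeff, LaurentPolynomial.T_apply]
  exact if_congr eq_comm rfl rfl

end Bispectral

/-! ### Lebesgue measure -/

section Lebesgue

open LaurentPolynomial (T)
open scoped InnerProductSpace

instance isProbabilityMeasure_lebesgueCircle : IsProbabilityMeasure lebesgueCircle := by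
  have : IsProbabilityMeasure (ENNReal.ofReal (2 * Real.pi)⁻¹ •
      (volume : Measure ℝ).restrict (Set.Ioc 0 (2 * Real.pi))) := ⟨by
    rw [Measure.smul_apply, Measure.restrict_apply_univ, Real.volume_Ioc, sub_zero, smul_eq_mul,
      ← ENNReal.ofReal_mul (by positivity), inv_mul_cancel₀ (by positivity), ENNReal.ofReal_one]⟩
  exact Measure.isProbabilityMeasure_map (by fun_prop)

lemma integral_zpow_lebesgueCircle (n : ℤ) :
    ∫ z : Circle, (z : ℂ) ^ n ∂lebesgueCircle = if n = 0 then 1 else 0 := by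
  split_ifs with hn
  · simp [hn]
  have h_cont : Continuous fun z : Circle => (z : ℂ) ^ n :=
    Continuous.zpow₀ (by fun_prop) n fun z => Or.inl z.coe_ne_zero
  have h_exp (θ : ℝ) : (Circle.exp θ : ℂ) ^ n = Complex.exp (n * Complex.I * θ) := by
    rw [Circle.coe_exp, ← Complex.exp_int_mul]
    ring_nf
  have h_period : Complex.exp (n * Complex.I * (2 * Real.pi : ℝ)) = 1 := by
    rw [← Complex.exp_int_mul_two_pi_mul_I n]
    push_cast
    ring_nf
  rw [lebesgueCircle, integral_map (by fun_prop) h_cont.aestronglyMeasurable,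
    integral_smul_measure, ← intervalIntegral.integral_of_le (by positivity)]
  simp only [h_exp]
  rw [integral_exp_mul_complex (by simp [hn]), h_period]
  simp

lemma inner_toL2_T_lebesgueCircle (j : ℤ) (f : ℂ[T;T⁻¹]) :
    ⟪toL2 lebesgueCircle (T j), toL2 lebesgueCircle f⟫_ℂ = f.coeff j := by
  induction f using LaurentPolynomial.induction_on' with
  | add f g hf hg =>
    rw [map_add, inner_add_right, hf, hg, AddMonoidAlgebra.coeff_add, Finsupp.add_apply]
  | C_mul_T i c =>
    have h_integrand (z : Circle) :
        ev z.toUnits (T i) * conj (ev z.toUnits (T j)) = (z : ℂ) ^ (i - j) := by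
      rw [ev_toUnits_T, ev_toUnits_T, map_zpow₀, ← Circle.coe_inv_eq_conj, Circle.coe_inv,
        inv_zpow', ← zpow_add₀ z.coe_ne_zero, sub_eq_add_neg]
    rw [← LaurentPolynomial.smul_eq_C_mul, map_smul, inner_smul_right, inner_toL2]
    simp only [h_integrand, integral_zpow_lebesgueCircle, AddMonoidAlgebra.coeff_smul,
      Finsupp.smul_apply, smul_eq_mul, LaurentPolynomial.T_apply, sub_eq_zero]

lemma norm_toL2_T (μ : Measure Circle) [IsProbabilityMeasure μ] (j : ℤ) :
    ‖toL2 μ (T j)‖ = 1 := by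
  rw [← one_mul (T j), norm_toL2_mul_T, norm_eq_sqrt_re_inner (𝕜 := ℂ), inner_toL2]
  simp

namespace IsOLP

variable {μ : Measure Circle} {x : ℕ → ℂ[T;T⁻¹]}

lemma norm_eq_one_of_eq_smul_T [IsProbabilityMeasure μ] (hx : IsOLP μ x) {n : ℕ} {c : ℂ} {j : ℤ}
    (h : x n = c • T j) : ‖c‖ = 1 := by
  simpa [h, norm_smul, norm_toL2_T] using hx.orthonormal_toL2.norm_eq_one n

lemma eq_smul_T_cmvExp (hx : IsOLP lebesgueCircle x) (n : ℕ) :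
    x n = (x n).coeff (cmvExp n) • T (cmvExp n) := by
  ext i
  obtain ⟨k, rfl⟩ := cmvExp_surjective i
  simp only [AddMonoidAlgebra.coeff_smul, Finsupp.smul_apply, LaurentPolynomial.T_apply,
    smul_eq_mul, mul_ite, mul_one, mul_zero, cmvExp_injective.eq_iff]
  split_ifs with hnk
  · rw [hnk]
  rcases lt_or_gt_of_ne hnk with hlt | hgt
  · exact coeff_cmvExp_eq_zero_of_mem_flag hlt (hx.mem_flag n)
  · rw [← inner_toL2_T_lebesgueCircle, inner_eq_zero_symm]
    exact hx.inner_eq_zero_of_mem_flag (flag_mono hgt (T_cmvExp_mem_flag k))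

end IsOLP

theorem isOLP_lebesgueCircle_iff {x : ℕ → ℂ[T;T⁻¹]} :
    IsOLP lebesgueCircle x ↔ ∀ n, ∃ c : ℂ, ‖c‖ = 1 ∧ x n = c • T (cmvExp n) := by
  refine ⟨fun hx n => ⟨_, hx.norm_eq_one_of_eq_smul_T (hx.eq_smul_T_cmvExp n),
    hx.eq_smul_T_cmvExp n⟩, fun h => ?_⟩
  choose c hc_norm hc using h
  refine ⟨fun n => ?_, fun m n => ?_⟩
  · rw [hc]
    exact Submodule.smul_mem _ _ (Submodule.subset_span ⟨n, Set.self_mem_Iic, rfl⟩)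
  · rw [← inner_toL2, hc m, hc n, map_smul, map_smul, inner_smul_left, inner_smul_right,
      inner_toL2_T_lebesgueCircle, LaurentPolynomial.T_apply]
    simp only [cmvExp_injective.eq_iff, mul_ite, mul_one, mul_zero]
    refine if_ctx_congr Iff.rfl (fun hmn => ?_) fun _ => rfl
    rw [hmn, Complex.conj_mul', hc_norm, Complex.ofReal_one, one_pow]

end Lebesgue

end CMVBispectral

end

theorem mainTheorem2 (μ : MeasureTheory.Measure Circle) [MeasureTheory.IsProbabilityMeasure μ]
    (hμ : μ.support.Infinite)
    (x : ℕ → LaurentPolynomial ℂ) (hx : CMVBispectral.IsOLP μ x) :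
    (∃ r : ℕ, 1 ≤ r ∧
      ∃ D : LaurentPolynomial ℂ →ₗ[ℂ] LaurentPolynomial ℂ, CMVBispectral.IsDiffOp r D ∧
        ∃ n₀ : ℕ, ∀ n ≥ n₀, D (x n) ∈ Submodule.span ℂ {x (n - 1), x n, x (n + 1)}) ↔
      CMVBispectral.IsOLP CMVBispectral.lebesgueCircle x := by
  rw [CMVBispectral.isOLP_lebesgueCircle_iff]
  constructor
  · rintro ⟨r, hr, D, hDr, n₀, hD⟩ n
    obtain ⟨c, hc⟩ := hx.exists_eq_smul_T_of_bispectral hr hDr hD n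
    exact ⟨c, hx.norm_eq_one_of_eq_smul_T hc, hc⟩
  · intro h
    refine ⟨1, le_rfl, CMVBispectral.euler, CMVBispectral.isDiffOp_euler, 0, fun n _ => ?_⟩
    obtain ⟨c, -, hc⟩ := h n
    have h_eigen : CMVBispectral.euler (x n) = (CMVBispectral.cmvExp n : ℂ) • x n := by
      rw [hc, map_smul, CMVBispectral.euler_T, smul_comm]
    rw [h_eigen]
    exact Submodule.smul_mem _ _ (Submodule.subset_span (by simp))
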